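/- **Notation.** Powers, $\sqrt{\cdot}$ and $\operatorname{Log}$ of nonzero complex numbers are principal ($\arg\in(-\pi,\pi]$). $J_\nu$, $Y_\nu$, $K_\nu$ are the Bessel functions of the first and second kind and the modified Bessel function of the second kind, where $Y_n$, $K_n$ for $n\in\mathbb Z$ are the limits of $Y_\nu$, $K_\nu$ as $\nu\to n$. Further, ${}_0F_5\left(-;b_1,\dots,b_5\,\middle|\,w\right)=\sum_{n\ge 0}\frac{1}{(b_1)_n\cdots(b_5)_n}\frac{w^n}{n!}$ with $(b)_n=b(b+1)\cdots(b+n-1)$. For parameters $b_1,\dots,b_q\in\mathbb C$ and $0\le m\le q$ let $$G^{m,0}_{0,q}\left(\begin{matrix}-\\ b_1,\dots,b_m;\,b_{m+1},\dots,b_q\end{matrix}\,\middle|\,z\right)=\frac1{2\pi i}\int_L\frac{\prod_{j=1}^m\Gamma(b_j-s)}{\prod_{j=m+1}^q\Gamma(1-b_j+s)}\,z^s\,ds ,$$ where $L$ is a loop that begins and ends at infinity on lines parallel to the positive real axis and encircles all poles of $\Gamma(b_j-s)$, $1\le j\le m$, once in the negative sense. For a number field $\mathbb K$ of degree $d=r_1+2r_2$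 and signature $(r_1,r_2)$, $\nu\in\mathbb C$ and $x\in\mathbb C\setminus\{0\}$, put $$G_{\mathbb K,\nu}(x)=G^{d+1,0}_{0,2(d+1)}\left(\begin{matrix}-\\ -\frac\nu2,\left(\frac\nu2\right)_{r_1+r_2},\left(\frac{1+\nu}2\right)_{r_2};\ \frac{1-\nu}2,\left(\frac\nu2\right)_{r_2},\left(\frac{1+\nu}2\right)_{r_1+r_2}\end{matrix}\,\middle|\,\frac{x^2}{16}\right),$$ where $(v)_\ell$ here denotes the $\ell$-tuple $(v,\dots,v)$ and $z=x^2/16$ is taken with $z^s=(x/4)^{2s}=e^{2s\operatorname{Log}(x/4)}$ (the principal value of $z^s$ if $-\frac\pi2<\arg x\le\frac\pi2$). **Theorem 1.2.** Let $x$ and $t$ be any nonzero complex numbers. (1) For $\mathbb K=\mathbb Q$ and every $\nu\in\mathbb C$, $$G_{\mathbb Q,\nu}(xt)=\cos(\pi\nu)\left\{\frac2\pi K_{2\nu}(2\sqrt{xt})-Y_{2\nu}(2\sqrt{xt})\right\}-\sin(\pi\nu)J_{2\nu}(2\sqrt{xt}).$$ (2) For every imaginary quadratic field $\mathbb K$ and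 every $\nu\in\mathbb C$ with $2\nu\notin\mathbb Z$, $$\begin{aligned}G_{\mathbb K,\nu}(xt)=\frac{\sqrt\pi}{\sin(2\pi\nu)}\Bigg\{&\frac{2^{1-4\nu}}{\Gamma(1-2\nu)^2}\left(\frac{xt}4\right)^{-\nu}{}_0F_5\left(-;1-\nu,1-\nu,\tfrac12-\nu,\tfrac12-\nu,\tfrac12\,\middle|\,-\frac{x^2t^2}{16}\right)\\&-\frac{2^{1+2\nu}\cos(\pi\nu)}{\Gamma(1+2\nu)}\left(\frac{xt}4\right)^{\nu}{}_0F_5\left(-;1+\nu,\tfrac12+\nu,\tfrac12,\tfrac12,1\,\middle|\,-\frac{x^2t^2}{16}\right)\\&+\frac{2^{4+2\nu}\sin(\pi\nu)}{\Gamma(2+2\nu)}\left(\frac{xt}4\right)^{1+\nu}{}_0F_5\left(-;\tfrac32+\nu,1+\nu,\tfrac32,\tfrac32,1\,\middle|\,-\frac{x^2t^2}{16}\right)\Bigg\}.\end{aligned}$$ -/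

import Mathlib

/-- The Bessel function of the first kind `J_ν(z) = ∑ (-1)^m (z/2)^(2m+ν) / (m! Γ(m+1+ν))`, with
principal powers. Mathlib's `Gamma` vanishes at its poles, so that `1 / Γ` is the entire reciprocal
Gamma function. -/
noncomputable def besselJ (ν z : ℂ) : ℂ :=
  ∑' m : ℕ, (-1) ^ m * (z / 2) ^ (2 * (m : ℂ) + ν) /
    ((m.factorial : ℂ) * Complex.Gamma ((m : ℂ) + 1 + ν))

/-- The quotient defining the Bessel function of the second kind at non-integral order. -/
noncomputable def besselYQuot (ν z : ℂ) : ℂ :=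
  (besselJ ν z * Complex.cos (Real.pi * ν) - besselJ (-ν) z) / Complex.sin (Real.pi * ν)

open Classical in
/-- The Bessel function of the second kind `Y_ν(z)`; at an integral order it is the limit over the
nearby non-integral orders. -/
noncomputable def besselY (ν z : ℂ) : ℂ :=
  if ∃ n : ℤ, ν = n then Filter.limUnder (nhdsWithin ν {ν}ᶜ) (fun μ => besselYQuot μ z)
  else besselYQuot ν z

/-- The modified Bessel function of the first kind `I_ν(z)`, through `J_ν` and the value of
`arg z ∈ (-π, π]`. -/
noncomputable def besselI (ν z : ℂ) : ℂ :=
  if Complex.arg z ≤ Real.pi / 2 then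
    Complex.exp (-(1 / 2) * Real.pi * ν * Complex.I) *
      besselJ ν (Complex.exp ((1 / 2) * Real.pi * Complex.I) * z)
  else
    Complex.exp ((3 / 2) * Real.pi * ν * Complex.I) *
      besselJ ν (Complex.exp (-(3 / 2) * Real.pi * Complex.I) * z)

/-- The quotient defining the modified Bessel function of the second kind at non-integral order. -/
noncomputable def besselKQuot (ν z : ℂ) : ℂ :=
  Real.pi / 2 * ((besselI (-ν) z - besselI ν z) / Complex.sin (ν * Real.pi))

open Classical in
/-- The modified Bessel function of the second kind `K_ν(z)`; at an integral order it is the limit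
over the nearby non-integral orders. -/
noncomputable def besselK (ν z : ℂ) : ℂ :=
  if ∃ n : ℤ, ν = n then Filter.limUnder (nhdsWithin ν {ν}ᶜ) (fun μ => besselKQuot μ z)
  else besselKQuot ν z

/-- The generalized hypergeometric function `pFq(a₁, …, a_p; b₁, …, b_q | z)`, as a power series
with the Pochhammer symbols `(a)_n = a (a + 1) ⋯ (a + n - 1)`. -/
noncomputable def hypergeometricPFQ (a b : List ℂ) (z : ℂ) : ℂ :=
  ∑' n : ℕ, (a.map fun c => (ascPochhammer ℂ n).eval c).prod /
    (b.map fun c => (ascPochhammer ℂ n).eval c).prod * (z ^ n / (n.factorial : ℂ))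

/-- The integrand `∏_{j ≤ m} Γ(b_j - s) / ∏_{m < j ≤ q} Γ(1 - b_j + s) · z^s` of the Meijer function
`G^{m,0}_{0,q}`. The lists are `b = (b_1, …, b_m)` and `b' = (b_{m+1}, …, b_q)`. The argument `z` is
a point of the Riemann surface of the logarithm, given by its logarithm `ℓ`: `z^s = exp (s ℓ)`. -/
noncomputable def meijerIntegrand (b b' : List ℂ) (ℓ s : ℂ) : ℂ :=
  (b.map fun c => Complex.Gamma (c - s)).prod /
    (b'.map fun c => Complex.Gamma (1 - c + s)).prod * Complex.exp (s * ℓ)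

/-- The abscissa of the left side of the contour of integration. -/
noncomputable def meijerAbscissa (b : List ℂ) : ℝ := -1 - (b.map fun c => |c.re|).sum

/-- The contour of integration lies in the strip `|Im s| ≤ meijerHeight b`. -/
noncomputable def meijerHeight (b : List ℂ) : ℝ := 1 + (b.map fun c => |c.im|).sum

/-- The Meijer function `G^{m,0}_{0,q}(- ; b_1, …, b_m ; b_{m+1}, …, b_q | z)`, `z = exp ℓ`, as the
Mellin-Barnes integral `(1 / 2πi) ∫_L` of `meijerIntegrand`. With `c` the abscissa and `T` the
height, `L` is the loop `∞ - iT → c - iT → c + iT → ∞ + iT`: it begins and ends at infinity on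
lines parallel to the positive real axis and encircles all the poles `b_j + k` (`j ≤ m`, `k ≥ 0`) of
the functions `Γ(b_j - s)` once in the negative sense. -/
noncomputable def meijerG (b b' : List ℂ) (ℓ : ℂ) : ℂ :=
  1 / (2 * Real.pi * Complex.I) *
    (-(∫ u in Set.Ioi (meijerAbscissa b),
          meijerIntegrand b b' ℓ ((u : ℂ) - (meijerHeight b : ℂ) * Complex.I))
      + Complex.I * (∫ v in (-meijerHeight b)..(meijerHeight b),
          meijerIntegrand b b' ℓ ((meijerAbscissa b : ℂ) + (v : ℂ) * Complex.I))
      + ∫ u in Set.Ioi (meijerAbscissa b),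
          meijerIntegrand b b' ℓ ((u : ℂ) + (meijerHeight b : ℂ) * Complex.I))

/-- The contour encircles the poles `c + k` of `Γ(c - s)` for every `c` in the list `b`. -/
theorem meijer_contour_encircles (b : List ℂ) (c : ℂ) (hc : c ∈ b) :
    meijerAbscissa b < c.re ∧ |c.im| < meijerHeight b := by
  have h1 : |c.re| ≤ (b.map fun c => |c.re|).sum :=
    List.single_le_sum (by simp +contextual) _ (List.mem_map_of_mem hc)
  have h2 : |c.im| ≤ (b.map fun c => |c.im|).sum :=
    List.single_le_sum (by simp +contextual) _ (List.mem_map_of_mem hc)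
  have h3 := neg_abs_le c.re
  constructor
  · unfold meijerAbscissa
    linarith
  · unfold meijerHeight
    linarith

/-- The kernel `G_{K,ν}(x)` of a number field `K` of degree `d` and signature `(r₁, r₂)`: the Meijer
function `G^{d+1,0}_{0,2(d+1)}` with parameters `-ν/2`, `(ν/2)_{r₁+r₂}`, `((1+ν)/2)_{r₂}`;
`(1-ν)/2`, `(ν/2)_{r₂}`, `((1+ν)/2)_{r₁+r₂}` at `z = x²/16 = (x/4)²`, where `z^s = (x/4)^{2s}`. -/
noncomputable def koshliakovKernel (K : Type*) [Field K] [NumberField K] (ν x : ℂ) : ℂ :=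
  let r₁ := NumberField.InfinitePlace.nrRealPlaces K
  let r₂ := NumberField.InfinitePlace.nrComplexPlaces K
  meijerG
    ([-ν / 2] ++ List.replicate (r₁ + r₂) (ν / 2) ++ List.replicate r₂ ((1 + ν) / 2))
    ([(1 - ν) / 2] ++ List.replicate r₂ (ν / 2) ++ List.replicate (r₁ + r₂) ((1 + ν) / 2))
    (2 * Complex.log (x / 4))

/-- In the half plane `-π/2 < arg x ≤ π/2` the determination of `log z` used in the kernel is the
principal logarithm of `z = x²/16`. -/
theorem two_mul_log_div_four (x : ℂ) (hx : x ≠ 0) (h₁ : -(Real.pi / 2) < Complex.arg x)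
    (h₂ : Complex.arg x ≤ Real.pi / 2) :
    2 * Complex.log (x / 4) = Complex.log (x ^ 2 / 16) := by
  have harg : (x / 4).arg = x.arg := by
    have h := Complex.arg_real_mul x (r := 1 / 4) (by norm_num)
    rw [← h]
    congr 1
    push_cast
    ring
  have h4 : x / 4 ≠ 0 := div_ne_zero hx (by norm_num)
  have e : Complex.exp (2 * Complex.log (x / 4)) = x ^ 2 / 16 := by
    rw [two_mul, Complex.exp_add, Complex.exp_log h4]
    ring
  rw [← e, Complex.log_exp]
  · simp [Complex.log_im, harg]
    linarith
  · simp [Complex.log_im, harg]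
    linarith

/-! Both formulas are evaluations of the Mellin-Barnes integral by residues. A product of gamma
factors in the numerator is first separated. By the reflection formula, `1 / Γ(1 - w) = Γ(w) sin(πw)
/ π`, so a trigonometric identity in the differences of the parameters writes the product as a sum
of terms `E(s) Γ(p - s)` with `E` entire (`Gamma_mul_Gamma_partial_fractions`,
`Gamma_mul_Gamma_mul_Gamma_partial_fractions`). It requires that no two parameters differ by an
integer, that is, that all poles are simple.

For one such term the loop is exhausted by rectangles whose right edges run midway between poles.
The residues reduce to the integral of `π cot` over a period. The remaining edge tends to zero
because `1 / Γ` decays faster than every exponential on horizontal half strips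
(`exists_norm_Gamma_inv_le`). This gives `loopIntegral_mul_Gamma_sub`, and with it `meijerG_two` and
`meijerG_three`.

For an imaginary quadratic field the three residue series are `₀F₅` series, and the duplication
formula brings their constants to the stated form. For the rational field duplication identifies the
residues with the terms of even index in the series of `I_{±2ν}`. Half of `I + J` consists of
exactly these terms, whence `(I_{-2ν} + J_{-2ν} - I_{2ν} - J_{2ν}) / (2 sin πν)`, which is the
combination of `K`, `Y`, `J` in the theorem.

That computation needs `2ν` to be non-integral. The remaining `ν` follow by a limit: the Meijer
function is continuous in `ν` (`continuous_meijerG_rational`), and `Y`, `K` at integral order are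
limits that exist because the Bessel series is entire in the order. -/

section
open Complex Filter Topology MeasureTheory Set
open scoped Interval

/-! ### Residues of `π / sin` on rectangles -/

/-- The integral over the boundary of the rectangle `[a, b] × [S, T]`, counterclockwise. -/
noncomputable def rectIntegral (f : ℂ → ℂ) (a b S T : ℝ) : ℂ :=
  (∫ u in a..b, f (u + S * I)) - (∫ u in a..b, f (u + T * I))
    + I * (∫ v in S..T, f (b + v * I)) - I * ∫ v in S..T, f (a + v * I)

theorem rectIntegral_eq_zero {f : ℂ → ℂ} {a b S T : ℝ}
    (h : DifferentiableOn ℂ f ([[a, b]] ×ℂ [[S, T]])) : rectIntegral f a b S T = 0 := by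
  simpa [rectIntegral] using
    integral_boundary_rect_eq_zero_of_differentiableOn f (⟨a, S⟩ : ℂ) (⟨b, T⟩ : ℂ) h

theorem rectIntegral_add_adjacent {f : ℂ → ℂ} {S T : ℝ} (a b c : ℝ)
    (hS : Continuous fun u : ℝ => f (u + S * I)) (hT : Continuous fun u : ℝ => f (u + T * I)) :
    rectIntegral f a b S T + rectIntegral f b c S T = rectIntegral f a c S T := by
  unfold rectIntegral
  rw [← intervalIntegral.integral_add_adjacent_intervals (hS.intervalIntegrable a b)
    (hS.intervalIntegrable b c), ← intervalIntegral.integral_add_adjacent_intervals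
    (hT.intervalIntegrable a b) (hT.intervalIntegrable b c)]
  ring

theorem rectIntegral_congr {f g : ℂ → ℂ} {a b S T : ℝ}
    (hre : ∀ s : ℂ, s.im = S ∨ s.im = T → f s = g s)
    (him : ∀ s : ℂ, s.re = a ∨ s.re = b → f s = g s) :
    rectIntegral f a b S T = rectIntegral g a b S T := by
  have h1 (u : ℝ) : f (u + S * I) = g (u + S * I) := hre _ (by simp)
  have h2 (u : ℝ) : f (u + T * I) = g (u + T * I) := hre _ (by simp)
  have h3 (u : ℝ) : f (a + u * I) = g (a + u * I) := him _ (by simp)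
  have h4 (u : ℝ) : f (b + u * I) = g (b + u * I) := him _ (by simp)
  simp only [rectIntegral, h1, h2, h3, h4]

theorem sin_pi_mul_ne_zero_of_forall_ne {w : ℂ} (hw : ∀ k : ℤ, w ≠ k) : sin (Real.pi * w) ≠ 0 := by
  rw [Ne, Complex.sin_eq_zero_iff]
  rintro ⟨k, hk⟩
  refine hw k (mul_left_cancel₀ (ofReal_ne_zero.2 Real.pi_ne_zero) (hk.trans (mul_comm _ _)))

theorem sin_pi_mul_ne_zero_of_im {w : ℂ} (hw : w.im ≠ 0) : sin (Real.pi * w) ≠ 0 :=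
  sin_pi_mul_ne_zero_of_forall_ne fun k hk => hw (by simp [hk])

/-- With `q = exp(2πi(u + iy))`, a primitive is `-πiu + log(1 - q)`. For `y > 0` one has `|q| < 1`,
so the principal logarithm is smooth along the path, and `q` has period one, so only the linear term
contributes. -/
theorem integral_pi_mul_cot_of_pos {y : ℝ} (hy : 0 < y) (a : ℝ) :
    ∫ u in a..(a + 1), (Real.pi : ℂ) * (cos (Real.pi * (u + y * I)) / sin (Real.pi * (u + y * I)))
      = -(Real.pi * I) := by
  have hpi := ofReal_ne_zero.2 Real.pi_ne_zero
  set q : ℝ → ℂ := fun u => exp (2 * Real.pi * I * (u + y * I)) with hq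
  have hq1 (u : ℝ) : ‖q u‖ < 1 := by
    simp only [hq, norm_exp]
    rw [Real.exp_lt_one_iff]
    simp
    have := mul_pos Real.pi_pos hy
    linarith
  have hq2 (u : ℝ) : 1 - q u ∈ slitPlane := by
    left
    have := (abs_le.1 (abs_re_le_norm (q u))).2
    simp
    linarith [hq1 u]
  have hsin (u : ℝ) : sin (Real.pi * (u + y * I)) ≠ 0 :=
    sin_pi_mul_ne_zero_of_im (by simpa using hy.ne')
  have hd (u : ℝ) : HasDerivAt (fun u : ℝ => -(Real.pi * I) * (u : ℂ) + log (1 - q u))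
      ((Real.pi : ℂ) * (cos (Real.pi * (u + y * I)) / sin (Real.pi * (u + y * I)))) u := by
    have h0 : HasDerivAt (fun u : ℝ => (u : ℂ)) 1 u := ofRealCLM.hasDerivAt
    have h1 : HasDerivAt q (exp (2 * Real.pi * I * (u + y * I)) * (2 * Real.pi * I * 1)) u :=
      ((h0.add_const _).const_mul _).cexp
    have h2 := (h1.const_sub 1).clog_real (hq2 u)
    refine ((h0.const_mul (-(Real.pi * I))).add h2).congr_deriv ?_
    have h3 : 1 - q u ≠ 0 := slitPlane_ne_zero (hq2 u)
    have e1 : q u = exp (Real.pi * (u + y * I) * I) / exp (-(Real.pi * (u + y * I)) * I) := by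
      rw [← Complex.exp_sub]
      simp only [hq]
      congr 1
      ring
    have e3 : exp (2 * Real.pi * I * (u + y * I)) = q u := rfl
    have h4 := hsin u
    rw [e3]
    simp only [Complex.cos, Complex.sin] at h4 ⊢
    rw [e1] at h3 ⊢
    have h5 := exp_ne_zero (-(Real.pi * (u + y * I)) * I)
    generalize exp (Real.pi * (u + y * I) * I) = X at *
    generalize exp (-(Real.pi * (u + y * I)) * I) = Y at *
    have h6 : Y - X ≠ 0 := by
      intro h
      apply h4
      rw [h]
      simp
    have h7 : 1 - X / Y = (Y - X) / Y := by field_simp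
    rw [h7]
    field_simp
    linear_combination -(X + Y) * I_sq
  rw [intervalIntegral.integral_eq_sub_of_hasDerivAt (fun u _ => hd u)]
  · have : q (a + 1) = q a := by
      simp only [hq]
      rw [← Complex.exp_periodic (2 * Real.pi * I * (a + y * I))]
      congr 1
      push_cast
      ring
    rw [this]
    push_cast
    ring
  · apply Continuous.intervalIntegrable
    exact continuous_const.mul (Continuous.div (by fun_prop) (by fun_prop) hsin)

theorem integral_pi_mul_cot_of_neg {y : ℝ} (hy : y < 0) (a : ℝ) :
    ∫ u in a..(a + 1), (Real.pi : ℂ) * (cos (Real.pi * (u + y * I)) / sin (Real.pi * (u + y * I)))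
      = Real.pi * I := by
  have h := integral_pi_mul_cot_of_pos (neg_pos.2 hy) (-(a + 1))
  have e : -(a + 1) + 1 = -a := by ring
  rw [e, ← intervalIntegral.integral_comp_neg] at h
  rw [← neg_inj, ← h, ← intervalIntegral.integral_neg]
  congr 1
  ext u
  have : (Real.pi : ℂ) * (((-u : ℝ) : ℂ) + ((-y : ℝ) : ℂ) * I) = -(Real.pi * (u + y * I)) := by
    push_cast
    ring
  rw [this, cos_neg, sin_neg]
  ring

theorem sub_ne_intCast_of_re {s q : ℂ} (h : s.re = q.re - 1 / 2 ∨ s.re = q.re + 1 / 2) (k : ℤ) :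
    s - q ≠ k := by
  intro hk
  have h1 := congrArg re hk
  simp at h1
  rcases h with h | h
  · have h2 : (((2 * k + 1 : ℤ)) : ℝ) = ((0 : ℤ) : ℝ) := by push_cast; linarith
    have h3 := Int.cast_injective h2
    omega
  · have h2 : (((2 * k - 1 : ℤ)) : ℝ) = ((0 : ℤ) : ℝ) := by push_cast; linarith
    have h3 := Int.cast_injective h2
    omega

/-- The residue theorem for `g s * π / sin (π (s - q))` on a box of width one about `q`. -/
theorem rectIntegral_mul_pi_div_sin {g : ℂ → ℂ} (hg : Differentiable ℂ g) {q : ℂ} {S T : ℝ}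
    (hS : S < q.im) (hT : q.im < T) :
    rectIntegral (fun s => g s * (Real.pi / sin (Real.pi * (s - q)))) (q.re - 1 / 2)
      (q.re + 1 / 2) S T = 2 * Real.pi * I * g q := by
  have hpi := ofReal_ne_zero.2 Real.pi_ne_zero
  -- Subtracting `g(q) π cot(π(s - q))` removes the pole: the numerator `h` that is left vanishes at
  -- `q`, and `D` continues `π h / σ` across `q` as a quotient of divided slopes.
  set h : ℂ → ℂ := fun s => g s - g q * cos (Real.pi * (s - q)) with hh
  set σ : ℂ → ℂ := fun s => sin (Real.pi * (s - q)) with hσ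
  have hσd : Differentiable ℂ σ := by fun_prop
  have hhd : Differentiable ℂ h := by fun_prop
  have hσq : σ q = 0 := by simp [hσ]
  have hhq : h q = 0 := by simp [hh]
  have hσ' : deriv σ q = Real.pi := by
    have : HasDerivAt σ (cos (Real.pi * (q - q)) * (Real.pi * 1)) q :=
      (((hasDerivAt_id q).sub_const q).const_mul _).csin
    rw [this.deriv]
    simp
  set D : ℂ → ℂ := fun s => dslope h q s / dslope σ q s * Real.pi with hD
  have hDs (s : ℂ) (hs : s ≠ q) : D s = h s / σ s * Real.pi := by
    simp only [hD]
    rw [dslope_of_ne _ hs, dslope_of_ne _ hs, slope_def_field, slope_def_field, hσq, hhq]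
    have := sub_ne_zero.2 hs
    rw [sub_zero, sub_zero, div_div_div_cancel_right₀ this]
  have hD0 : rectIntegral D (q.re - 1 / 2) (q.re + 1 / 2) S T = 0 := by
    apply rectIntegral_eq_zero
    have d1 := (Complex.differentiableOn_dslope (c := q) univ_mem).2 hhd.differentiableOn
    have d2 := (Complex.differentiableOn_dslope (c := q) univ_mem).2 hσd.differentiableOn
    refine ((d1.mono (subset_univ _)).div (d2.mono (subset_univ _)) ?_).mul_const _
    intro s hs
    by_cases hsq : s = q
    · rw [hsq, dslope_same, hσ']
      exact hpi
    rw [dslope_of_ne _ hsq, slope_def_field, hσq, sub_zero]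
    refine div_ne_zero (sin_pi_mul_ne_zero_of_forall_ne fun k hk => ?_) (sub_ne_zero.2 hsq)
    have h1 := hs.1
    rw [mem_preimage, uIcc_of_le (by linarith)] at h1
    have h2 : s.re - q.re = k := by simpa using congrArg re hk
    have h3 : k < 1 := by
      have : (k : ℝ) < 1 := by linarith [h1.2]
      exact_mod_cast this
    have h4 : -1 < k := by
      have : (-1 : ℝ) < k := by linarith [h1.1]
      exact_mod_cast this
    have h5 : k = 0 := by omega
    rw [h5] at hk
    exact hsq (sub_eq_zero.1 (by simpa using hk))
  have split : ∀ (γ : ℝ → ℂ), Continuous γ → (∀ u, σ (γ u) ≠ 0) → ∀ a b : ℝ,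
      ∫ u in a..b, g (γ u) * (Real.pi / σ (γ u)) = (∫ u in a..b, D (γ u)) +
        g q * ∫ u in a..b, Real.pi * (cos (Real.pi * (γ u - q)) / sin (Real.pi * (γ u - q))) := by
    intro γ hγ hne a b
    have c1 : Continuous fun u => g (γ u) * (Real.pi / σ (γ u)) :=
      (hg.continuous.comp hγ).mul (continuous_const.div (hσd.continuous.comp hγ) hne)
    have c2 : Continuous fun u =>
        Real.pi * (cos (Real.pi * (γ u - q)) / sin (Real.pi * (γ u - q))) :=
      continuous_const.mul (Continuous.div (by fun_prop) (by fun_prop) hne)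
    have e (u : ℝ) : D (γ u) = g (γ u) * (Real.pi / σ (γ u)) -
        g q * (Real.pi * (cos (Real.pi * (γ u - q)) / sin (Real.pi * (γ u - q)))) := by
      have h1 : γ u ≠ q := fun h => hne u (by rw [h, hσq])
      rw [hDs _ h1]
      have := hne u
      simp only [hσ, hh] at this ⊢
      field_simp
    simp only [e]
    rw [intervalIntegral.integral_sub (c1.intervalIntegrable _ _)
      ((c2.const_mul _).intervalIntegrable _ _), intervalIntegral.integral_const_mul]
    ring
  have neS (u : ℝ) : σ (u + S * I) ≠ 0 :=
    sin_pi_mul_ne_zero_of_im (by simpa [sub_eq_zero] using hS.ne)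
  have neT (u : ℝ) : σ (u + T * I) ≠ 0 :=
    sin_pi_mul_ne_zero_of_im (by simpa [sub_eq_zero] using hT.ne')
  have nea (v : ℝ) : σ (((q.re - 1 / 2 : ℝ) : ℂ) + v * I) ≠ 0 :=
    sin_pi_mul_ne_zero_of_forall_ne fun k => sub_ne_intCast_of_re (Or.inl (by simp)) k
  have neb (v : ℝ) : σ (((q.re + 1 / 2 : ℝ) : ℂ) + v * I) ≠ 0 :=
    sin_pi_mul_ne_zero_of_forall_ne fun k => sub_ne_intCast_of_re (Or.inr (by simp)) k
  -- The box has the width of a period of the cotangent, so its vertical sides cancel; each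
  -- horizontal side contributes `πi`.
  have period (v : ℝ) :
      cos (Real.pi * (((q.re + 1 / 2 : ℝ) : ℂ) + v * I - q)) /
        sin (Real.pi * (((q.re + 1 / 2 : ℝ) : ℂ) + v * I - q)) =
      cos (Real.pi * (((q.re - 1 / 2 : ℝ) : ℂ) + v * I - q)) /
        sin (Real.pi * (((q.re - 1 / 2 : ℝ) : ℂ) + v * I - q)) := by
    have : (Real.pi : ℂ) * (((q.re + 1 / 2 : ℝ) : ℂ) + v * I - q) =
        Real.pi * (((q.re - 1 / 2 : ℝ) : ℂ) + v * I - q) + Real.pi := by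
      push_cast
      ring
    rw [this, Complex.cos_add_pi, Complex.sin_add_pi, neg_div_neg_eq]
  have hor (y : ℝ) : (∫ u in (q.re - 1 / 2)..(q.re + 1 / 2), (Real.pi : ℂ) *
      (cos (Real.pi * ((u : ℂ) + y * I - q)) / sin (Real.pi * ((u : ℂ) + y * I - q)))) =
      ∫ u in (-1 / 2 : ℝ)..(-1 / 2 + 1), (Real.pi : ℂ) *
      (cos (Real.pi * ((u : ℂ) + ((y - q.im : ℝ) : ℂ) * I)) /
        sin (Real.pi * ((u : ℂ) + ((y - q.im : ℝ) : ℂ) * I))) := by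
    have e (u : ℝ) : ((u : ℂ) + y * I - q) = ((u - q.re : ℝ) : ℂ) + ((y - q.im : ℝ) : ℂ) * I := by
      conv_lhs => rw [← re_add_im q]
      push_cast
      ring
    simp only [e]
    rw [intervalIntegral.integral_comp_sub_right (fun u : ℝ => (Real.pi : ℂ) *
      (cos (Real.pi * ((u : ℂ) + ((y - q.im : ℝ) : ℂ) * I)) /
        sin (Real.pi * ((u : ℂ) + ((y - q.im : ℝ) : ℂ) * I)))) q.re]
    congr 1 <;> ring
  unfold rectIntegral at hD0 ⊢
  change (∫ u in _.._, g (_ + _) * (Real.pi / σ (_ + _))) - (∫ u in _.._, g (_ + _) *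
    (Real.pi / σ (_ + _))) + I * (∫ u in _.._, g (_ + _) * (Real.pi / σ (_ + _))) -
    I * (∫ u in _.._, g (_ + _) * (Real.pi / σ (_ + _))) = _
  rw [split (fun u => u + S * I) (by fun_prop) neS, split (fun u => u + T * I) (by fun_prop) neT,
    split (fun v => ((q.re - 1 / 2 : ℝ) : ℂ) + v * I) (by fun_prop) nea,
    split (fun v => ((q.re + 1 / 2 : ℝ) : ℂ) + v * I) (by fun_prop) neb]
  simp only [period, hor]
  rw [integral_pi_mul_cot_of_neg (sub_neg.2 hS), integral_pi_mul_cot_of_pos (sub_pos.2 hT)]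
  linear_combination hD0

/-! ### The loop integral with a single gamma factor -/

/-- The integral over the loop `∞ - iT → c - iT → c + iT → ∞ + iT`. -/
noncomputable def loopIntegral (F : ℂ → ℂ) (c T : ℝ) : ℂ :=
  -(∫ u in Ioi c, F ((u : ℂ) - (T : ℂ) * I))
    + I * (∫ v in (-T)..T, F ((c : ℂ) + (v : ℂ) * I))
    + ∫ u in Ioi c, F ((u : ℂ) + (T : ℂ) * I)

theorem Complex.sin_add_intCast_mul_pi (z : ℂ) (n : ℤ) :
    sin (z + n * Real.pi) = (-1) ^ n * sin z :=
  n.cast_negOnePow ℂ ▸ Complex.sin_antiperiodic.add_int_mul_eq n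

theorem Complex.sin_add_natCast_mul_pi (z : ℂ) (n : ℕ) :
    sin (z + n * Real.pi) = (-1) ^ n * sin z :=
  Complex.sin_antiperiodic.add_nat_mul_eq n

theorem Complex.cos_add_natCast_mul_pi (z : ℂ) (n : ℕ) :
    cos (z + n * Real.pi) = (-1) ^ n * cos z :=
  Complex.cos_antiperiodic.add_nat_mul_eq n

theorem norm_sin_ge_of_im (w : ℂ) : |Real.sinh w.im| ≤ ‖sin w‖ := by
  have h : ‖sin w‖ = ‖exp (-w * I) - exp (w * I)‖ / 2 := by
    simp [Complex.sin]
  have h2 := abs_norm_sub_norm_le (exp (-w * I)) (exp (w * I))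
  rw [h, Real.sinh_eq, abs_div]
  simp only [norm_exp] at h2
  simp at h2
  simp
  linarith

/-- `|sin(πw)| ≥ sinh(π|Im w|) ≥ π`. Hence the contour is kept at distance at least one from the
rows of poles. -/
theorem norm_pi_div_sin_le {w : ℂ} (h : 1 ≤ |w.im|) :
    ‖(Real.pi : ℂ) / sin (Real.pi * w)‖ ≤ 1 := by
  have h1 := norm_sin_ge_of_im (Real.pi * w)
  have h2 : Real.pi ≤ |Real.sinh (Real.pi * w).im| := by
    rw [Real.abs_sinh]
    simp only [mul_im, ofReal_re, ofReal_im, zero_mul, add_zero, abs_mul, abs_of_pos Real.pi_pos]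
    calc Real.pi ≤ Real.pi * |w.im| := le_mul_of_one_le_right Real.pi_pos.le h
      _ ≤ _ := Real.self_le_sinh_iff.2 (by positivity)
  rw [norm_div, norm_real, Real.norm_of_nonneg Real.pi_pos.le]
  exact div_le_one_of_le₀ (h2.trans h1) (norm_nonneg _)

/-- On these vertical lines the sine is `±cosh(π Im w)`. -/
theorem one_le_norm_sin_of_re {w : ℂ} {n : ℤ} (h : w.re = n + 1 / 2) :
    1 ≤ ‖sin (Real.pi * w)‖ := by
  have e : (Real.pi : ℂ) * w = ((Real.pi * w.im : ℝ) : ℂ) * I + Real.pi / 2 + n * Real.pi := by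
    conv_lhs => rw [← re_add_im w, h]
    push_cast
    ring
  rw [e, Complex.sin_add_intCast_mul_pi, Complex.sin_add_pi_div_two, cos_mul_I, norm_mul, norm_zpow,
    norm_neg, norm_one, one_zpow, one_mul, ← ofReal_cosh, norm_real]
  exact (Real.one_le_cosh _).trans (le_abs_self _)

theorem Gamma_eq_pi_div_sin_mul_inv {w : ℂ} (hw : ∀ k : ℤ, w ≠ k) :
    Gamma w = Real.pi / sin (Real.pi * w) * (Gamma (1 - w))⁻¹ := by
  have h : Gamma (1 - w) ≠ 0 := Gamma_ne_zero fun m hm => hw (m + 1) (by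
    push_cast
    linear_combination -hm)
  rw [← Gamma_mul_Gamma_one_sub]
  field_simp

theorem tendsto_exp_neg_atTop_zero' (a : ℝ) :
    Tendsto (fun N : ℕ => Real.exp (-(a + N))) atTop (𝓝 0) :=
  Real.tendsto_exp_neg_atTop_nhds_zero.comp
    (tendsto_atTop_add_const_left _ a tendsto_natCast_atTop_atTop)

theorem continuous_mul_Gamma_sub {E : ℂ → ℂ} (hE : Differentiable ℂ E) {p : ℂ} {y : ℝ}
    (hy : y ≠ p.im) : Continuous fun u : ℝ => E (u + y * I) * Gamma (p - (u + y * I)) := by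
  refine (hE.continuous.comp (by fun_prop)).mul (continuous_iff_continuousAt.2 fun u => ?_)
  refine ContinuousAt.comp (f := fun u : ℝ => p - (u + y * I)) (g := Gamma) ?_ (by fun_prop)
  refine (differentiableAt_Gamma _ fun m hm => hy ?_).continuousAt
  have := congrArg im hm
  simp at this
  linarith

/-- Reflection exchanges `Γ(p - s)` for `1 / Γ(1 - p + s)` at the price of a factor `π / sin`, which
is harmless at this height. All growth estimates thus concern reciprocal gamma functions only. -/
theorem norm_mul_Gamma_sub_le {E : ℂ → ℂ} {p s : ℂ} (hs : 1 ≤ |(p - s).im|) :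
    ‖E s * Gamma (p - s)‖ ≤ ‖E s * (Gamma (1 - p + s))⁻¹‖ := by
  have h1 (k : ℤ) : p - s ≠ k := fun h => by
    rw [h] at hs
    norm_num at hs
  have h2 : 1 - (p - s) = 1 - p + s := by ring
  rw [Gamma_eq_pi_div_sin_mul_inv h1, h2]
  calc _ = ‖E s * (Gamma (1 - p + s))⁻¹‖ * ‖(Real.pi : ℂ) / sin (Real.pi * (p - s))‖ := by
        rw [← norm_mul]
        congr 1
        ring
    _ ≤ _ := mul_le_of_le_one_right (norm_nonneg _) (norm_pi_div_sin_le hs)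

theorem integrableOn_mul_Gamma_sub {E : ℂ → ℂ} (hE : Differentiable ℂ E) {p : ℂ} {c y C : ℝ}
    (hy : 1 ≤ |p.im - y|)
    (hC : ∀ u : ℝ, c ≤ u → ‖E (u + y * I) * (Gamma (1 - p + (u + y * I)))⁻¹‖ ≤ C * Real.exp (-u)) :
    IntegrableOn (fun u : ℝ => E (u + y * I) * Gamma (p - (u + y * I))) (Ioi c) := by
  have hne : y ≠ p.im := by
    rintro rfl
    norm_num at hy
  refine Integrable.mono' (g := fun u => C * Real.exp (-u)) ?_
    (continuous_mul_Gamma_sub hE hne).aestronglyMeasurable ?_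
  · exact (integrableOn_exp_neg_Ioi c).const_mul C
  · refine (ae_restrict_iff' measurableSet_Ioi).2 (Eventually.of_forall fun u hu => ?_)
    exact (norm_mul_Gamma_sub_le (by simpa using hy)).trans (hC u (le_of_lt hu))

/-- By reflection the integrand is an entire function times `π / sin(π(p - s))`. Recentring the sine
at `p + N` costs the sign `-(-1)^N`, and `1 / Γ(1 - p + s)` takes the value `1 / N!` there. -/
theorem rectIntegral_mul_Gamma_sub_box {E : ℂ → ℂ} (hE : Differentiable ℂ E) {p : ℂ} {T : ℝ}
    (hT : |p.im| < T) (N : ℕ) :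
    rectIntegral (fun s => E s * Gamma (p - s)) (p.re + N - 1 / 2) (p.re + N + 1 / 2) (-T) T =
      -(2 * Real.pi * I * ((-1) ^ N / N.factorial * E (p + N))) := by
  have hT' := abs_lt.1 hT
  have hG : Differentiable ℂ fun s => -((-1) ^ N * (E s * (Gamma (1 - p + s))⁻¹)) :=
    ((hE.mul (differentiable_one_div_Gamma.comp (by fun_prop))).const_mul _).neg
  have key := rectIntegral_mul_pi_div_sin hG (q := p + N) (S := -T) (T := T)
    (by simpa using hT'.1) (by simpa using hT'.2)
  have e1 : (p + (N : ℂ)).re = p.re + N := by simp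
  have e2 : 1 - p + (p + (N : ℂ)) = N + 1 := by ring
  rw [e1, e2, Complex.Gamma_nat_eq_factorial] at key
  have hpt (s : ℂ) (h : ∀ k : ℤ, p - s ≠ k) : E s * Gamma (p - s) =
      -((-1) ^ N * (E s * (Gamma (1 - p + s))⁻¹)) *
        (Real.pi / sin (Real.pi * (s - (p + N)))) := by
    have e3 : 1 - (p - s) = 1 - p + s := by ring
    have e4 : (Real.pi : ℂ) * (s - (p + N)) = -(Real.pi * (p - s) + N * Real.pi) := by ring
    rw [Gamma_eq_pi_div_sin_mul_inv h, e3, e4, Complex.sin_neg, Complex.sin_add_natCast_mul_pi]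
    rcases neg_one_pow_eq_or ℂ N with h | h <;> rw [h] <;> ring
  rw [rectIntegral_congr (g := fun s => -((-1) ^ N * (E s * (Gamma (1 - p + s))⁻¹)) *
        (Real.pi / sin (Real.pi * (s - (p + N))))), key]
  · ring
  · intro s hs
    refine hpt s fun k hk => ?_
    have := congrArg im hk
    simp at this
    rcases hs with hs | hs <;> linarith
  · intro s hs
    refine hpt s fun k hk => ?_
    have e5 : s - (p + N) = ((-k - N : ℤ) : ℂ) := by
      push_cast
      linear_combination -hk
    exact sub_ne_intCast_of_re (by simpa using hs) _ e5

theorem rectIntegral_mul_Gamma_sub {E : ℂ → ℂ} (hE : Differentiable ℂ E) {p : ℂ} {c T : ℝ}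
    (hc : c < p.re) (hT : |p.im| < T) (N : ℕ) :
    rectIntegral (fun s => E s * Gamma (p - s)) c (p.re + N - 1 / 2) (-T) T =
      -(2 * Real.pi * I * ∑ k ∈ Finset.range N, (-1) ^ k / k.factorial * E (p + k)) := by
  have hT' := abs_lt.1 hT
  have c1 := continuous_mul_Gamma_sub hE (p := p) (y := -T) hT'.1.ne
  have c2 := continuous_mul_Gamma_sub hE (p := p) (y := T) hT'.2.ne'
  induction N with
  | zero =>
    rw [Finset.sum_range_zero, mul_zero, neg_zero]
    -- The edge `Re p - 1/2` may lie on either side of `c`; in both cases the rectangle stays to the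
    -- left of `Re p`, where there are no poles.
    refine rectIntegral_eq_zero fun s hs => ?_
    refine DifferentiableAt.differentiableWithinAt (hE.differentiableAt.mul ?_)
    refine (differentiableAt_Gamma _ fun m hm => ?_).comp s (by fun_prop)
    have h1 : s.re ≤ max c (p.re + (0 : ℕ) - 1 / 2) := hs.1.2
    have h2 : s.re < p.re := h1.trans_lt (max_lt hc (by norm_num))
    have h3 : p.re - s.re = -m := by simpa using congrArg re hm
    have h4 : (0 : ℝ) ≤ m := by positivity
    linarith
  | succ N ih =>
    rw [← rectIntegral_add_adjacent c (p.re + N - 1 / 2) (p.re + (N + 1 : ℕ) - 1 / 2) c1 c2, ih,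
      Finset.sum_range_succ, mul_add, neg_add, ← rectIntegral_mul_Gamma_sub_box hE hT N]
    congr 2
    push_cast
    ring

/-- The Mellin-Barnes integral with a single gamma factor, as the sum of its residues. -/
theorem loopIntegral_mul_Gamma_sub {E : ℂ → ℂ} (hE : Differentiable ℂ E) {p : ℂ} {c T C : ℝ}
    (hc : c < p.re) (hT : |p.im| + 1 ≤ T)
    (hC : ∀ s : ℂ, c ≤ s.re → |s.im| ≤ T →
      ‖E s * (Gamma (1 - p + s))⁻¹‖ ≤ C * Real.exp (-s.re)) :
    loopIntegral (fun s => E s * Gamma (p - s)) c T =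
      2 * Real.pi * I * ∑' k : ℕ, (-1) ^ k / k.factorial * E (p + k) := by
  have hT1 : |p.im| < T := by linarith
  have hT' := abs_le.1 (show |p.im| ≤ T - 1 by linarith)
  have hT0 : 0 < T := (abs_nonneg _).trans_lt hT1
  have i1 := integrableOn_mul_Gamma_sub hE (p := p) (c := c) (y := -T) (C := C)
    (by rw [le_abs]; left; linarith) fun u hu => by
      simpa using hC (u + ((-T : ℝ) : ℂ) * I) (by simpa using hu) (by simp [abs_of_pos hT0])
  have i2 := integrableOn_mul_Gamma_sub hE (p := p) (c := c) (y := T) (C := C)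
    (by rw [le_abs]; right; linarith) fun u hu => by
      simpa using hC (u + (T : ℂ) * I) (by simpa using hu) (by simp [abs_of_pos hT0])
  have hlim : Tendsto (fun N : ℕ => p.re + N - 1 / 2) atTop atTop := by
    have := tendsto_atTop_add_const_left _ (p.re - 1 / 2)
      (tendsto_natCast_atTop_atTop (R := ℝ))
    refine this.congr fun N => ?_
    ring
  have l1 := intervalIntegral_tendsto_integral_Ioi c i1 hlim
  have l2 := intervalIntegral_tendsto_integral_Ioi c i2 hlim
  -- The right edge lies midway between two poles, where `|sin| ≥ 1`, so the bound `hC` makes its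
  -- integral `O(exp(-N))`.
  have l3 : Tendsto (fun N : ℕ => ∫ v in (-T)..T, (fun s => E s * Gamma (p - s))
      (((p.re + N - 1 / 2 : ℝ) : ℂ) + v * I)) atTop (𝓝 0) := by
    have hb : Tendsto (fun N : ℕ => C * Real.pi * Real.exp (-(p.re - 1 / 2 + N)) * |T - -T|) atTop
        (𝓝 (C * Real.pi * 0 * |T - -T|)) :=
      ((tendsto_exp_neg_atTop_zero' _).const_mul _).mul_const _
    rw [mul_zero, zero_mul] at hb
    refine squeeze_zero_norm' ?_ hb
    -- From `N = 1` on the edge lies to the right of `c`, so that `hC` applies.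
    filter_upwards [eventually_ge_atTop 1] with N hN
    have hN' : (1 : ℝ) ≤ N := by exact_mod_cast hN
    refine intervalIntegral.norm_integral_le_of_norm_le_const fun v hv => ?_
    rw [uIoc_of_le (by linarith)] at hv
    set s : ℂ := ((p.re + N - 1 / 2 : ℝ) : ℂ) + v * I with hs
    have hsre : s.re = p.re + N - 1 / 2 := by simp [hs]
    have hsim : s.im = v := by simp [hs]
    have hb1 := hC s (by rw [hsre]; linarith) (by rw [hsim]; exact abs_le.2 ⟨hv.1.le, hv.2⟩)
    have hw : (p - s).re = ((-N : ℤ) : ℝ) + 1 / 2 := by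
      rw [sub_re, hsre]
      push_cast
      ring
    have hne (k : ℤ) : p - s ≠ k := fun h => by
      have h1 : (k : ℝ) = ((-N : ℤ) : ℝ) + 1 / 2 := by rw [← hw, h, intCast_re]
      have h2 : ((2 * k + 2 * N - 1 : ℤ) : ℝ) = ((0 : ℤ) : ℝ) := by
        push_cast at h1 ⊢
        linarith
      have := Int.cast_injective h2
      omega
    have e3 : 1 - (p - s) = 1 - p + s := by ring
    have hsin : ‖(Real.pi : ℂ) / sin (Real.pi * (p - s))‖ ≤ Real.pi := by
      rw [norm_div, norm_real, Real.norm_of_nonneg Real.pi_pos.le]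
      exact div_le_self Real.pi_pos.le (one_le_norm_sin_of_re hw)
    change ‖E s * Gamma (p - s)‖ ≤ _
    rw [Gamma_eq_pi_div_sin_mul_inv hne, e3, mul_left_comm, norm_mul]
    rw [hsre] at hb1
    calc _ ≤ Real.pi * (C * Real.exp (-(p.re + N - 1 / 2))) := by gcongr
      _ = _ := by
        rw [show p.re + N - 1 / 2 = p.re - 1 / 2 + N by ring]
        ring
  have hR := ((l1.sub l2).add (l3.const_mul I)).sub_const
    (I * ∫ v in (-T)..T, (fun s => E s * Gamma (p - s)) ((c : ℂ) + v * I))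
  -- At the poles `Γ(1 - p + s)` is `k!`, so the same bound `hC` dominates the residues.
  have hsum : Summable fun k : ℕ => (-1) ^ k / (k.factorial : ℂ) * E (p + k) := by
    have hs : Summable fun k : ℕ => C * Real.exp (-p.re) * Real.exp (-(k : ℝ)) := by
      refine Summable.mul_left _ ?_
      simpa using Real.summable_exp_neg_nat
    refine Summable.of_norm_bounded hs fun k => ?_
    have h1 := hC (p + k) (by simp; linarith [k.cast_nonneg (α := ℝ)]) (by simpa using hT1.le)
    have e2 : 1 - p + (p + (k : ℂ)) = k + 1 := by ring
    rw [e2, Complex.Gamma_nat_eq_factorial] at h1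
    have e3 : ‖(-1) ^ k / (k.factorial : ℂ) * E (p + k)‖ = ‖E (p + k) * (k.factorial : ℂ)⁻¹‖ := by
      simp [div_eq_mul_inv, mul_comm]
    rw [e3, mul_assoc, ← Real.exp_add]
    rwa [← neg_add, show p.re + (k : ℝ) = (p + (k : ℂ)).re by simp]
  have hS := ((hsum.hasSum.tendsto_sum_nat.const_mul (2 * Real.pi * I)).neg)
  have huniq := tendsto_nhds_unique (hS.congr fun N =>
    (rectIntegral_mul_Gamma_sub hE hc hT1 N).symm) hR
  rw [neg_eq_iff_eq_neg] at huniq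
  rw [huniq, loopIntegral]
  simp only [ofReal_neg, neg_mul, ← sub_eq_add_neg]
  ring

/-! ### Decay of reciprocal gamma functions -/

/-- The reciprocal gamma function decays faster than any exponential on horizontal half strips. -/
theorem exists_norm_Gamma_inv_le (c T A : ℝ) :
    ∃ C, 0 ≤ C ∧ ∀ w : ℂ, c ≤ w.re → |w.im| ≤ T →
      ‖(Gamma w)⁻¹‖ ≤ C * Real.exp (-(A * w.re)) := by
  -- Once `Re w > c + N + 1`, one has `|w - 1| ≥ exp A`, and `1 / Γ(w - 1) = (w - 1) / Γ(w)` gains a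
  -- factor `exp(-A)` per unit step. Compactness covers the initial rectangle.
  obtain ⟨N, hN⟩ := exists_nat_ge (Real.exp A - c)
  have hK : IsCompact (Icc c (c + N + 1) ×ℂ Icc (-T) T) := isCompact_Icc.reProdIm isCompact_Icc
  have hcont : Continuous fun w : ℂ => ‖(Gamma w)⁻¹‖ * Real.exp (A * w.re) :=
    differentiable_one_div_Gamma.continuous.norm.mul (by fun_prop)
  obtain ⟨C, hC⟩ := hK.exists_bound_of_continuousOn hcont.continuousOn
  refine ⟨max C 0, le_max_right _ _, ?_⟩
  have key : ∀ n : ℕ, ∀ w : ℂ, c ≤ w.re → w.re ≤ c + N + 1 + n → |w.im| ≤ T →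
      ‖(Gamma w)⁻¹‖ ≤ max C 0 * Real.exp (-(A * w.re)) := by
    intro n
    induction n with
    | zero =>
      intro w h1 h2 h3
      have h := hC w ⟨⟨h1, by simpa using h2⟩, abs_le.1 h3⟩
      rw [Real.norm_of_nonneg (by positivity)] at h
      rw [Real.exp_neg, ← div_eq_mul_inv, le_div_iff₀ (Real.exp_pos _)]
      exact h.trans (le_max_left _ _)
    | succ n ih =>
      intro w h1 h2 h3
      by_cases h4 : w.re ≤ c + N + 1 + n
      · exact ih w h1 h4 h3
      push Not at h4
      have hn : (0 : ℝ) ≤ n := n.cast_nonneg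
      have hN0 : (0 : ℝ) ≤ N := N.cast_nonneg
      push_cast at h2
      have h5 := ih (w - 1) (by simp; linarith) (by simp; linarith) (by simpa using h3)
      have h6 : Real.exp A ≤ ‖w - 1‖ := by
        refine le_trans ?_ (re_le_norm _)
        simp
        linarith
      have h7 := one_div_Gamma_eq_self_mul_one_div_Gamma_add_one (w - 1)
      rw [sub_add_cancel] at h7
      rw [h7, norm_mul] at h5
      have e : Real.exp (-(A * (w - 1).re)) = Real.exp A * Real.exp (-(A * w.re)) := by
        rw [← Real.exp_add]
        simp
        ring
      rw [e] at h5
      have h8 : Real.exp A * ‖(Gamma w)⁻¹‖ ≤ Real.exp A * (max C 0 * Real.exp (-(A * w.re))) := by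
        calc _ ≤ ‖w - 1‖ * ‖(Gamma w)⁻¹‖ := by gcongr
          _ ≤ _ := h5
          _ = _ := by ring
      exact le_of_mul_le_mul_left h8 (Real.exp_pos _)
  intro w h1 h2
  obtain ⟨n, hn⟩ := exists_nat_ge (w.re - (c + N + 1))
  exact key n w h1 (by linarith) h2

theorem exists_norm_Gamma_inv_add_le (c T A R : ℝ) :
    ∃ C, 0 ≤ C ∧ ∀ a s : ℂ, ‖a‖ ≤ R → c ≤ s.re → |s.im| ≤ T →
      ‖(Gamma (a + s))⁻¹‖ ≤ C * Real.exp (-(A * s.re)) := by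
  obtain ⟨C, hC0, hC⟩ := exists_norm_Gamma_inv_le (c - R) (T + R) A
  refine ⟨C * Real.exp (|A| * R), by positivity, fun a s ha h1 h2 => ?_⟩
  have h3 := abs_le.1 ((abs_re_le_norm a).trans ha)
  have h4 := (abs_im_le_norm a).trans ha
  refine (hC (a + s) (by simp; linarith) ?_).trans ?_
  · rw [add_im]
    exact (abs_add_le _ _).trans (by linarith)
  · rw [mul_assoc, ← Real.exp_add]
    gcongr
    rw [add_re]
    have h5 : -(A * a.re) ≤ |A| * R := by
      refine (neg_le_abs _).trans ?_
      rw [abs_mul]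
      gcongr
      exact abs_le.2 h3
    linarith

theorem exists_norm_prod_Gamma_inv_le (n : ℕ) (c T A R : ℝ) :
    ∃ C, 0 ≤ C ∧ ∀ (as : List ℂ) (s : ℂ), as.length = n + 1 → (∀ a ∈ as, ‖a‖ ≤ R) → c ≤ s.re →
      |s.im| ≤ T → ‖(as.map fun a => (Gamma (a + s))⁻¹).prod‖ ≤ C * Real.exp (-(A * s.re)) := by
  induction n with
  | zero =>
    obtain ⟨C, hC0, hC⟩ := exists_norm_Gamma_inv_add_le c T A R
    refine ⟨C, hC0, fun as s hl ha h1 h2 => ?_⟩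
    obtain ⟨a, rfl⟩ := List.length_eq_one_iff.1 hl
    simpa using hC a s (ha a (by simp)) h1 h2
  | succ n ih =>
    -- One factor suffices for the decay; the others need only be bounded, which is the rate zero.
    obtain ⟨C, hC0, hC⟩ := exists_norm_Gamma_inv_add_le c T 0 R
    obtain ⟨D, hD0, hD⟩ := ih
    refine ⟨C * D, by positivity, fun as s hl ha h1 h2 => ?_⟩
    obtain ⟨a, l, rfl⟩ := List.exists_cons_of_length_eq_add_one hl
    have h3 := hC a s (ha a (by simp)) h1 h2
    have h4 := hD l s (by simpa using hl) (fun b hb => ha b (by simp [hb])) h1 h2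
    rw [List.map_cons, List.prod_cons, norm_mul, mul_assoc]
    simp only [zero_mul, neg_zero, Real.exp_zero, mul_one] at h3
    exact mul_le_mul h3 h4 (norm_nonneg _) hC0

/-- Products of reciprocal gamma functions dominate `exp (s ℓ)` on horizontal half strips,
uniformly in bounded parameters. -/
theorem exists_norm_prod_Gamma_inv_mul_exp_le (n : ℕ) (c T R : ℝ) (ℓ : ℂ) :
    ∃ C, 0 ≤ C ∧ ∀ (as : List ℂ) (s : ℂ), as.length = n + 1 → (∀ a ∈ as, ‖a‖ ≤ R) → c ≤ s.re →
      |s.im| ≤ T → ‖(as.map fun a => (Gamma (a + s))⁻¹).prod * exp (s * ℓ)‖ ≤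
        C * Real.exp (-s.re) := by
  -- The rate `1 + Re ℓ` absorbs the growth of `exp(sℓ)` and leaves `exp(-Re s)`.
  obtain ⟨C, hC0, hC⟩ := exists_norm_prod_Gamma_inv_le n c T (1 + ℓ.re) R
  refine ⟨C * Real.exp (T * |ℓ.im|), by positivity, fun as s hl ha h1 h2 => ?_⟩
  rw [norm_mul, norm_exp]
  have h3 : (s * ℓ).re ≤ s.re * ℓ.re + T * |ℓ.im| := by
    rw [mul_re]
    have : -(s.im * ℓ.im) ≤ T * |ℓ.im| := by
      refine (neg_le_abs _).trans ?_
      rw [abs_mul]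
      gcongr
    linarith
  calc _ ≤ C * Real.exp (-((1 + ℓ.re) * s.re)) * Real.exp (s.re * ℓ.re + T * |ℓ.im|) :=
        mul_le_mul (hC as s hl ha h1 h2) (Real.exp_le_exp.2 h3) (Real.exp_pos _).le (by positivity)
    _ = _ := by
      rw [mul_assoc, mul_assoc, ← Real.exp_add, ← Real.exp_add]
      ring_nf

/-! ### Additivity of the loop integral -/

/-- Integrability along the three sides of the loop. -/
structure LoopIntegrable (F : ℂ → ℂ) (c T : ℝ) : Prop where
  bottom : IntegrableOn (fun u : ℝ => F ((u : ℂ) - (T : ℂ) * I)) (Ioi c)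
  left : IntervalIntegrable (fun v : ℝ => F ((c : ℂ) + (v : ℂ) * I)) volume (-T) T
  top : IntegrableOn (fun u : ℝ => F ((u : ℂ) + (T : ℂ) * I)) (Ioi c)

theorem LoopIntegrable.add {F G : ℂ → ℂ} {c T : ℝ} (hF : LoopIntegrable F c T)
    (hG : LoopIntegrable G c T) : LoopIntegrable (fun s => F s + G s) c T :=
  ⟨hF.bottom.add hG.bottom, hF.left.add hG.left, hF.top.add hG.top⟩

theorem loopIntegral_add {F G : ℂ → ℂ} {c T : ℝ} (hF : LoopIntegrable F c T)
    (hG : LoopIntegrable G c T) :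
    loopIntegral (fun s => F s + G s) c T = loopIntegral F c T + loopIntegral G c T := by
  simp only [loopIntegral]
  rw [integral_add hF.bottom hG.bottom, integral_add hF.top hG.top,
    intervalIntegral.integral_add hF.left hG.left]
  ring

theorem loopIntegral_congr {F G : ℂ → ℂ} {c T : ℝ}
    (h : ∀ s : ℂ, s.im = -T ∨ s.im = T ∨ s.re = c → F s = G s) :
    loopIntegral F c T = loopIntegral G c T := by
  have h1 (u : ℝ) : F (u - T * I) = G (u - T * I) := h _ (by simp)
  have h2 (u : ℝ) : F (u + T * I) = G (u + T * I) := h _ (by simp)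
  have h3 (u : ℝ) : F (c + u * I) = G (c + u * I) := h _ (by simp)
  simp only [loopIntegral, h1, h2, h3]

theorem sub_ne_neg_natCast_of_loop {p s : ℂ} {c T : ℝ} (hc : c < p.re) (hT : |p.im| < T)
    (h : s.im = -T ∨ s.im = T ∨ s.re = c) (m : ℕ) : p - s ≠ -m := by
  intro hm
  have h1 := congrArg re hm
  have h2 := congrArg im hm
  simp at h1 h2
  have h3 := abs_lt.1 hT
  have h4 : (0 : ℝ) ≤ m := m.cast_nonneg
  rcases h with h | h | h <;> linarith

theorem loopIntegrable_mul_Gamma_sub {E : ℂ → ℂ} (hE : Differentiable ℂ E) {p : ℂ} {c T C : ℝ}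
    (hc : c < p.re) (hT : |p.im| + 1 ≤ T)
    (hC : ∀ s : ℂ, c ≤ s.re → |s.im| ≤ T →
      ‖E s * (Gamma (1 - p + s))⁻¹‖ ≤ C * Real.exp (-s.re)) :
    LoopIntegrable (fun s => E s * Gamma (p - s)) c T := by
  have hT1 : |p.im| < T := by linarith
  have hT' := abs_le.1 (show |p.im| ≤ T - 1 by linarith)
  have hT0 : 0 < T := (abs_nonneg _).trans_lt hT1
  refine ⟨?_, ?_, ?_⟩
  · have := integrableOn_mul_Gamma_sub hE (p := p) (c := c) (y := -T) (C := C)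
      (by rw [le_abs]; left; linarith) fun u hu => by
        simpa using hC (u + ((-T : ℝ) : ℂ) * I) (by simpa using hu) (by simp [abs_of_pos hT0])
    simpa only [ofReal_neg, neg_mul, ← sub_eq_add_neg] using this
  · refine Continuous.intervalIntegrable (continuous_iff_continuousAt.2 fun v => ?_) _ _
    refine (hE.continuous.comp (by fun_prop)).continuousAt.mul ?_
    refine ContinuousAt.comp (f := fun v : ℝ => p - ((c : ℂ) + v * I)) (g := Gamma) ?_
      (by fun_prop)
    exact (differentiableAt_Gamma _ fun m =>
      sub_ne_neg_natCast_of_loop hc hT1 (by simp) m).continuousAt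
  · exact integrableOn_mul_Gamma_sub hE (p := p) (c := c) (y := T) (C := C)
      (by rw [le_abs]; right; linarith) fun u hu => by
        simpa using hC (u + (T : ℂ) * I) (by simpa using hu) (by simp [abs_of_pos hT0])

/-! ### Partial fractions for products of gamma functions -/

/-- Positive integers `w` must be included, since `p - s` can take such values on the vertical side
of the loop. -/
theorem inv_Gamma_one_sub {w : ℂ} (hw : ∀ m : ℕ, w ≠ -m) :
    (Gamma (1 - w))⁻¹ = Gamma w * sin (Real.pi * w) / Real.pi := by
  have hpi := ofReal_ne_zero.2 Real.pi_ne_zero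
  have hG := Gamma_ne_zero hw
  by_cases h : sin (Real.pi * w) = 0
  -- Here `1 - w` is a pole; with division by zero equal to zero, the reflection formula forces `Γ(1
  -- - w) = 0`, and both sides vanish.
  · have h2 := Gamma_mul_Gamma_one_sub w
    rw [h, div_zero, mul_eq_zero, or_iff_right hG] at h2
    rw [h, h2]
    simp
  · rw [eq_div_iff hpi, inv_mul_eq_iff_eq_mul₀, ← mul_assoc, mul_comm (Gamma (1 - w)),
      Gamma_mul_Gamma_one_sub]
    · field_simp
    · intro h2
      have := Gamma_mul_Gamma_one_sub w
      rw [h2, mul_zero, eq_comm, div_eq_zero_iff] at this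
      exact this.elim hpi h

/-- This is `sin(b - a) = sin b cos a - cos b sin a` for `a = πA`, `b = πB`, with each sine absorbed
into a reciprocal gamma function. -/
theorem Gamma_mul_Gamma_partial_fractions {A B : ℂ} (hA : ∀ m : ℕ, A ≠ -m) (hB : ∀ m : ℕ, B ≠ -m)
    (hs : sin (Real.pi * (B - A)) ≠ 0) :
    Gamma A * Gamma B = Real.pi / sin (Real.pi * (B - A)) *
      (cos (Real.pi * A) * (Gamma (1 - B))⁻¹ * Gamma A
        - cos (Real.pi * B) * (Gamma (1 - A))⁻¹ * Gamma B) := by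
  have hpi := ofReal_ne_zero.2 Real.pi_ne_zero
  rw [inv_Gamma_one_sub hA, inv_Gamma_one_sub hB]
  have e : (Real.pi : ℂ) * (B - A) = Real.pi * B - Real.pi * A := mul_sub _ _ _
  rw [e, Complex.sin_sub] at hs ⊢
  field_simp

/-- Division by all six sines gives partial fractions of `1 / (sin A sin B sin C)` whose
coefficients depend only on the differences. Under a common shift by `s` they are constant, so no
cosines appear, in contrast to two factors. -/
theorem sin_partial_fractions (A B C : ℂ) :
    sin B * sin C * sin (C - B) - sin A * sin C * sin (C - A) + sin A * sin B * sin (B - A) =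
      sin (B - A) * sin (C - A) * sin (C - B) := by
  rw [Complex.sin_sub, Complex.sin_sub, Complex.sin_sub]
  have hA := Complex.sin_sq_add_cos_sq A
  have hB := Complex.sin_sq_add_cos_sq B
  have hC := Complex.sin_sq_add_cos_sq C
  linear_combination -(sin B * sin C * (sin C * cos B - cos C * sin B)) * hA +
    (sin A * sin C * (sin C * cos A - cos C * sin A)) * hB -
    (sin A * sin B * (sin B * cos A - cos B * sin A)) * hC

theorem Gamma_mul_Gamma_mul_Gamma_partial_fractions {A B C : ℂ} (hA : ∀ m : ℕ, A ≠ -m)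
    (hB : ∀ m : ℕ, B ≠ -m) (hC : ∀ m : ℕ, C ≠ -m) (hBA : sin (Real.pi * (B - A)) ≠ 0)
    (hCA : sin (Real.pi * (C - A)) ≠ 0) (hCB : sin (Real.pi * (C - B)) ≠ 0) :
    Gamma A * Gamma B * Gamma C =
      Real.pi ^ 2 / (sin (Real.pi * (B - A)) * sin (Real.pi * (C - A))) *
          ((Gamma (1 - B))⁻¹ * (Gamma (1 - C))⁻¹ * Gamma A)
        - Real.pi ^ 2 / (sin (Real.pi * (B - A)) * sin (Real.pi * (C - B))) *
          ((Gamma (1 - A))⁻¹ * (Gamma (1 - C))⁻¹ * Gamma B)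
        + Real.pi ^ 2 / (sin (Real.pi * (C - A)) * sin (Real.pi * (C - B))) *
          ((Gamma (1 - A))⁻¹ * (Gamma (1 - B))⁻¹ * Gamma C) := by
  have hpi := ofReal_ne_zero.2 Real.pi_ne_zero
  have key := sin_partial_fractions (Real.pi * A) (Real.pi * B) (Real.pi * C)
  rw [inv_Gamma_one_sub hA, inv_Gamma_one_sub hB, inv_Gamma_one_sub hC]
  simp only [← mul_sub] at key
  field_simp
  linear_combination -(Gamma A * Gamma B * Gamma C) * key

/-! ### Meijer functions as sums of residues -/

theorem norm_cos_le_exp (w : ℂ) : ‖cos w‖ ≤ Real.exp |w.im| := by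
  have h : cos w = (exp (w * I) + exp (-w * I)) / 2 := rfl
  rw [h, norm_div]
  have h1 : ‖exp (w * I)‖ ≤ Real.exp |w.im| := by
    rw [norm_exp]
    simpa using neg_le_abs w.im
  have h2 : ‖exp (-w * I)‖ ≤ Real.exp |w.im| := by
    rw [norm_exp]
    simpa using le_abs_self w.im
  have h3 := norm_add_le (exp (w * I)) (exp (-w * I))
  simp only [Complex.norm_ofNat]
  linarith

theorem abs_im_add_one_le_meijerHeight {b : List ℂ} {c : ℂ} (hc : c ∈ b) :
    |c.im| + 1 ≤ meijerHeight b := by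
  have h : |c.im| ≤ (b.map fun c => |c.im|).sum :=
    List.single_le_sum (by simp +contextual) _ (List.mem_map_of_mem hc)
  unfold meijerHeight
  linarith

theorem meijerG_eq_loopIntegral (b b' : List ℂ) (ℓ : ℂ) :
    meijerG b b' ℓ = 1 / (2 * Real.pi * I) *
      loopIntegral (meijerIntegrand b b' ℓ) (meijerAbscissa b) (meijerHeight b) := rfl

theorem differentiable_Gamma_inv_add (a : ℂ) : Differentiable ℂ fun s => (Gamma (a + s))⁻¹ :=
  differentiable_one_div_Gamma.comp (by fun_prop)

/-- The bounds on `E s / Γ(1 - p + s)` under which `E s * Γ(p - s)` can be integrated over the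
loop. -/
def LoopBound (E : ℂ → ℂ) (p : ℂ) (c T : ℝ) : Prop :=
  ∃ C, ∀ s : ℂ, c ≤ s.re → |s.im| ≤ T → ‖E s * (Gamma (1 - p + s))⁻¹‖ ≤ C * Real.exp (-s.re)

theorem loopBound_of_prod {E : ℂ → ℂ} {p : ℂ} {c T : ℝ} (as : List ℂ) (has : as ≠ []) (ℓ : ℂ)
    (h : ℂ → ℂ) {M : ℝ} (hM : ∀ s : ℂ, |s.im| ≤ T → ‖h s‖ ≤ M)
    (hE : ∀ s, E s * (Gamma (1 - p + s))⁻¹ =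
      h s * ((as.map fun a => (Gamma (a + s))⁻¹).prod * exp (s * ℓ))) : LoopBound E p c T := by
  obtain ⟨n, hn⟩ := Nat.exists_eq_succ_of_ne_zero (mt List.length_eq_zero_iff.1 has)
  obtain ⟨C, hC0, hC⟩ := exists_norm_prod_Gamma_inv_mul_exp_le n c T ((as.map norm).sum) ℓ
  refine ⟨M * C, fun s h1 h2 => ?_⟩
  rw [hE, norm_mul, mul_assoc]
  refine mul_le_mul (hM s h2) (hC as s hn (fun a ha => ?_) h1 h2) (norm_nonneg _)
    ((norm_nonneg _).trans (hM s h2))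
  exact List.single_le_sum (by simp +contextual) _ (List.mem_map_of_mem ha)

/-- The Meijer function with two gamma factors in the numerator and simple poles, as a sum of
residues. -/
theorem meijerG_two {p q d e ℓ : ℂ} (hpq : sin (Real.pi * (q - p)) ≠ 0) :
    meijerG [p, q] [d, e] ℓ = Real.pi / sin (Real.pi * (q - p)) *
      ((∑' k : ℕ, (k.factorial : ℂ)⁻¹ * ((Gamma (1 - q + (p + k)))⁻¹ * (Gamma (1 - d + (p + k)))⁻¹ *
          (Gamma (1 - e + (p + k)))⁻¹ * exp ((p + k) * ℓ)))
        - ∑' k : ℕ, (k.factorial : ℂ)⁻¹ * ((Gamma (1 - p + (q + k)))⁻¹ *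
          (Gamma (1 - d + (q + k)))⁻¹ * (Gamma (1 - e + (q + k)))⁻¹ * exp ((q + k) * ℓ))) := by
  set b : List ℂ := [p, q] with hb
  have hp := meijer_contour_encircles b p (by simp [hb])
  have hq := meijer_contour_encircles b q (by simp [hb])
  have hpT := abs_im_add_one_le_meijerHeight (b := b) (c := p) (by simp [hb])
  have hqT := abs_im_add_one_le_meijerHeight (b := b) (c := q) (by simp [hb])
  rw [meijerG_eq_loopIntegral]
  set c := meijerAbscissa b
  set T := meijerHeight b
  set κ : ℂ := Real.pi / sin (Real.pi * (q - p)) with hκ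
  set R : ℂ → ℂ := fun s => (Gamma (1 - d + s))⁻¹ * (Gamma (1 - e + s))⁻¹ * exp (s * ℓ) with hR
  have hRd : Differentiable ℂ R :=
    ((differentiable_Gamma_inv_add _).mul (differentiable_Gamma_inv_add _)).mul (by fun_prop)
  set E₁ : ℂ → ℂ := fun s => κ * cos (Real.pi * (p - s)) * ((Gamma (1 - q + s))⁻¹ * R s) with hE₁
  set E₂ : ℂ → ℂ := fun s => -κ * cos (Real.pi * (q - s)) * ((Gamma (1 - p + s))⁻¹ * R s) with hE₂
  have d₁ : Differentiable ℂ E₁ :=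
    Differentiable.mul (by fun_prop) ((differentiable_Gamma_inv_add _).mul hRd)
  have d₂ : Differentiable ℂ E₂ :=
    Differentiable.mul (by fun_prop) ((differentiable_Gamma_inv_add _).mul hRd)
  -- The cosines grow only with `|Im s|`, so they are bounded on the strip and do not affect the
  -- decay.
  have hcos (κ r : ℂ) (s : ℂ) (hs : |s.im| ≤ T) : ‖κ * cos (Real.pi * (r - s))‖ ≤
      ‖κ‖ * Real.exp (Real.pi * (|r.im| + T)) := by
    rw [norm_mul]
    refine mul_le_mul_of_nonneg_left ((norm_cos_le_exp _).trans ?_) (norm_nonneg _)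
    gcongr
    simp only [mul_im, ofReal_re, ofReal_im, zero_mul, add_zero, abs_mul, abs_of_pos Real.pi_pos,
      sub_im]
    gcongr
    exact (abs_sub _ _).trans (by linarith)
  obtain ⟨C₁, hC₁⟩ : LoopBound E₁ p c T :=
    loopBound_of_prod [1 - p, 1 - q, 1 - d, 1 - e] (by simp) ℓ _ (hcos κ p) fun s => by
      simp [hE₁, hR]
      ring
  obtain ⟨C₂, hC₂⟩ : LoopBound E₂ q c T :=
    loopBound_of_prod [1 - p, 1 - q, 1 - d, 1 - e] (by simp) ℓ _ (hcos (-κ) q) fun s => by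
      simp [hE₂, hR]
      ring
  have hF : loopIntegral (meijerIntegrand b [d, e] ℓ) c T =
      loopIntegral (fun s => E₁ s * Gamma (p - s) + E₂ s * Gamma (q - s)) c T := by
    refine loopIntegral_congr fun s hs => ?_
    have hps := sub_ne_neg_natCast_of_loop hp.1 hp.2 hs
    have hqs := sub_ne_neg_natCast_of_loop hq.1 hq.2 hs
    have e1 : q - s - (p - s) = q - p := by ring
    have e2 : 1 - (q - s) = 1 - q + s := by ring
    have e3 : 1 - (p - s) = 1 - p + s := by ring
    have key := Gamma_mul_Gamma_partial_fractions hps hqs (by rwa [e1])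
    rw [e1, e2, e3, ← hκ] at key
    simp only [meijerIntegrand, hb, List.map_cons, List.map_nil, List.prod_cons, List.prod_nil,
      mul_one, hE₁, hE₂, hR]
    rw [key, div_eq_mul_inv, mul_inv]
    ring
  rw [hF, loopIntegral_add (loopIntegrable_mul_Gamma_sub d₁ hp.1 hpT hC₁)
    (loopIntegrable_mul_Gamma_sub d₂ hq.1 hqT hC₂), loopIntegral_mul_Gamma_sub d₁ hp.1 hpT hC₁,
    loopIntegral_mul_Gamma_sub d₂ hq.1 hqT hC₂, ← mul_add, ← mul_assoc, one_div_mul_cancel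
    Complex.two_pi_I_ne_zero, one_mul, mul_sub, ← tsum_mul_left, ← tsum_mul_left, sub_eq_add_neg,
    ← tsum_neg]
  -- At the poles the cosine is `(-1)^k` and cancels the sign of the residue of the gamma factor.
  have hck (r : ℂ) (k : ℕ) : cos (Real.pi * (r - (r + k))) = (-1) ^ k := by
    have h := Complex.cos_add_natCast_mul_pi 0 k
    rw [zero_add, Complex.cos_zero, mul_one] at h
    rw [← h, ← Complex.cos_neg]
    congr 1
    ring
  have hsq (k : ℕ) : ((-1 : ℂ) ^ k) * (-1) ^ k = 1 := by
    rw [← mul_pow]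
    simp
  congr 1 <;> refine tsum_congr fun k => ?_
  · simp only [hE₁, hR, hck]
    linear_combination (κ * (k.factorial : ℂ)⁻¹ * (Gamma (1 - q + (p + k)))⁻¹ *
      (Gamma (1 - d + (p + k)))⁻¹ * (Gamma (1 - e + (p + k)))⁻¹ * exp ((p + k) * ℓ)) * hsq k
  · simp only [hE₂, hR, hck]
    linear_combination -(κ * (k.factorial : ℂ)⁻¹ * (Gamma (1 - p + (q + k)))⁻¹ *
      (Gamma (1 - d + (q + k)))⁻¹ * (Gamma (1 - e + (q + k)))⁻¹ * exp ((q + k) * ℓ)) * hsq k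

/-- The Meijer function with three gamma factors in the numerator and simple poles, as a sum of
residues. -/
theorem meijerG_three {p q r d e f ℓ : ℂ} (hqp : sin (Real.pi * (q - p)) ≠ 0)
    (hrp : sin (Real.pi * (r - p)) ≠ 0) (hrq : sin (Real.pi * (r - q)) ≠ 0) :
    meijerG [p, q, r] [d, e, f] ℓ =
      Real.pi ^ 2 / (sin (Real.pi * (q - p)) * sin (Real.pi * (r - p))) *
        (∑' k : ℕ, (-1) ^ k / (k.factorial : ℂ) * ((Gamma (1 - q + (p + k)))⁻¹ *
          (Gamma (1 - r + (p + k)))⁻¹ * (Gamma (1 - d + (p + k)))⁻¹ * (Gamma (1 - e + (p + k)))⁻¹ *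
          (Gamma (1 - f + (p + k)))⁻¹ * exp ((p + k) * ℓ)))
      - Real.pi ^ 2 / (sin (Real.pi * (q - p)) * sin (Real.pi * (r - q))) *
        (∑' k : ℕ, (-1) ^ k / (k.factorial : ℂ) * ((Gamma (1 - p + (q + k)))⁻¹ *
          (Gamma (1 - r + (q + k)))⁻¹ * (Gamma (1 - d + (q + k)))⁻¹ * (Gamma (1 - e + (q + k)))⁻¹ *
          (Gamma (1 - f + (q + k)))⁻¹ * exp ((q + k) * ℓ)))
      + Real.pi ^ 2 / (sin (Real.pi * (r - p)) * sin (Real.pi * (r - q))) *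
        (∑' k : ℕ, (-1) ^ k / (k.factorial : ℂ) * ((Gamma (1 - p + (r + k)))⁻¹ *
          (Gamma (1 - q + (r + k)))⁻¹ * (Gamma (1 - d + (r + k)))⁻¹ * (Gamma (1 - e + (r + k)))⁻¹ *
          (Gamma (1 - f + (r + k)))⁻¹ * exp ((r + k) * ℓ))) := by
  set b : List ℂ := [p, q, r] with hb
  have hp := meijer_contour_encircles b p (by simp [hb])
  have hq := meijer_contour_encircles b q (by simp [hb])
  have hr := meijer_contour_encircles b r (by simp [hb])
  have hpT := abs_im_add_one_le_meijerHeight (b := b) (c := p) (by simp [hb])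
  have hqT := abs_im_add_one_le_meijerHeight (b := b) (c := q) (by simp [hb])
  have hrT := abs_im_add_one_le_meijerHeight (b := b) (c := r) (by simp [hb])
  rw [meijerG_eq_loopIntegral]
  set c := meijerAbscissa b
  set T := meijerHeight b
  set κ₁ : ℂ := Real.pi ^ 2 / (sin (Real.pi * (q - p)) * sin (Real.pi * (r - p))) with hκ₁
  set κ₂ : ℂ := Real.pi ^ 2 / (sin (Real.pi * (q - p)) * sin (Real.pi * (r - q))) with hκ₂
  set κ₃ : ℂ := Real.pi ^ 2 / (sin (Real.pi * (r - p)) * sin (Real.pi * (r - q))) with hκ₃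
  set R : ℂ → ℂ := fun s => (Gamma (1 - d + s))⁻¹ * (Gamma (1 - e + s))⁻¹ *
    (Gamma (1 - f + s))⁻¹ * exp (s * ℓ) with hR
  have hRd : Differentiable ℂ R :=
    (((differentiable_Gamma_inv_add _).mul (differentiable_Gamma_inv_add _)).mul
      (differentiable_Gamma_inv_add _)).mul (by fun_prop)
  set E : ℂ → ℂ → ℂ → ℂ → ℂ := fun κ x y s => κ * ((Gamma (1 - x + s))⁻¹ *
    (Gamma (1 - y + s))⁻¹ * R s) with hE
  have hd (κ x y : ℂ) : Differentiable ℂ (E κ x y) :=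
    (((differentiable_Gamma_inv_add _).mul (differentiable_Gamma_inv_add _)).mul hRd).const_mul _
  have hbound (κ x y z : ℂ) : LoopBound (E κ x y) z c T :=
    loopBound_of_prod [1 - x, 1 - y, 1 - z, 1 - d, 1 - e, 1 - f] (by simp) ℓ (fun _ => κ)
      (fun _ _ => le_rfl) fun s => by
        simp [hE, hR]
        ring
  obtain ⟨C₁, hC₁⟩ := hbound κ₁ q r p
  obtain ⟨C₂, hC₂⟩ := hbound (-κ₂) p r q
  obtain ⟨C₃, hC₃⟩ := hbound κ₃ p q r
  have hF : loopIntegral (meijerIntegrand b [d, e, f] ℓ) c T =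
      loopIntegral (fun s => E κ₁ q r s * Gamma (p - s) + E (-κ₂) p r s * Gamma (q - s) +
        E κ₃ p q s * Gamma (r - s)) c T := by
    refine loopIntegral_congr fun s hs => ?_
    have hps := sub_ne_neg_natCast_of_loop hp.1 hp.2 hs
    have hqs := sub_ne_neg_natCast_of_loop hq.1 hq.2 hs
    have hrs := sub_ne_neg_natCast_of_loop hr.1 hr.2 hs
    have e1 : q - s - (p - s) = q - p := by ring
    have e2 : r - s - (p - s) = r - p := by ring
    have e3 : r - s - (q - s) = r - q := by ring
    have e4 (x : ℂ) : 1 - (x - s) = 1 - x + s := by ring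
    have key := Gamma_mul_Gamma_mul_Gamma_partial_fractions hps hqs hrs (by rwa [e1]) (by rwa [e2])
      (by rwa [e3])
    rw [e1, e2, e3, e4, e4, e4, ← hκ₁, ← hκ₂, ← hκ₃] at key
    simp only [meijerIntegrand, hb, List.map_cons, List.map_nil, List.prod_cons, List.prod_nil,
      mul_one, hE, hR]
    rw [← mul_assoc, key, div_eq_mul_inv, mul_inv, mul_inv]
    ring
  have i₁ := loopIntegrable_mul_Gamma_sub (hd _ _ _) hp.1 hpT hC₁
  have i₂ := loopIntegrable_mul_Gamma_sub (hd _ _ _) hq.1 hqT hC₂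
  have i₃ := loopIntegrable_mul_Gamma_sub (hd _ _ _) hr.1 hrT hC₃
  rw [hF, loopIntegral_add (i₁.add i₂) i₃, loopIntegral_add i₁ i₂,
    loopIntegral_mul_Gamma_sub (hd _ _ _) hp.1 hpT hC₁,
    loopIntegral_mul_Gamma_sub (hd _ _ _) hq.1 hqT hC₂,
    loopIntegral_mul_Gamma_sub (hd _ _ _) hr.1 hrT hC₃, ← mul_add, ← mul_add, ← mul_assoc,
    one_div_mul_cancel Complex.two_pi_I_ne_zero, one_mul, ← tsum_mul_left, ← tsum_mul_left,
    ← tsum_mul_left, sub_eq_add_neg, ← tsum_neg]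
  congr 1
  · congr 1 <;> refine tsum_congr fun k => ?_ <;> simp only [hE, hR] <;> ring
  · refine tsum_congr fun k => ?_
    simp only [hE, hR]
    ring

/-! ### Imaginary quadratic fields -/

theorem Gamma_add_natCast_inv {a : ℂ} (ha : ∀ m : ℕ, a ≠ -m) (k : ℕ) :
    (Gamma (a + k))⁻¹ = (Gamma a)⁻¹ * ((ascPochhammer ℂ k).eval a)⁻¹ := by
  rw [← Gamma_add_nat_div_Gamma_eq a ha, inv_div, ← mul_div_assoc,
    inv_mul_cancel₀ (Gamma_ne_zero ha), one_div]

/-- Each `Γ(a + k)` is `Γ(a) (a)_k`; the alternating sign is absorbed into the argument `-exp ℓ`. -/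
theorem tsum_prod_Gamma_inv_eq_hypergeometricPFQ {a₁ a₂ a₃ a₄ a₅ p ℓ : ℂ}
    (h₁ : ∀ m : ℕ, a₁ ≠ -m) (h₂ : ∀ m : ℕ, a₂ ≠ -m) (h₃ : ∀ m : ℕ, a₃ ≠ -m)
    (h₄ : ∀ m : ℕ, a₄ ≠ -m) (h₅ : ∀ m : ℕ, a₅ ≠ -m) {F : ℕ → ℂ}
    (hF : ∀ k : ℕ, F k = (-1) ^ k / (k.factorial : ℂ) * ((Gamma (a₁ + k))⁻¹ *
      (Gamma (a₂ + k))⁻¹ * (Gamma (a₃ + k))⁻¹ * (Gamma (a₄ + k))⁻¹ * (Gamma (a₅ + k))⁻¹ *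
      exp ((p + k) * ℓ))) :
    ∑' k : ℕ, F k =
      (Gamma a₁ * Gamma a₂ * Gamma a₃ * Gamma a₄ * Gamma a₅)⁻¹ * exp (p * ℓ) *
        hypergeometricPFQ [] [a₁, a₂, a₃, a₄, a₅] (-exp ℓ) := by
  rw [hypergeometricPFQ, ← tsum_mul_left]
  refine tsum_congr fun k => (hF k).trans ?_
  have he : exp ((p + k) * ℓ) = exp (p * ℓ) * exp ℓ ^ k := by
    rw [← Complex.exp_nat_mul, ← Complex.exp_add]
    ring_nf
  simp only [Gamma_add_natCast_inv h₁, Gamma_add_natCast_inv h₂, Gamma_add_natCast_inv h₃,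
    Gamma_add_natCast_inv h₄, Gamma_add_natCast_inv h₅, he, List.map_nil, List.prod_nil,
    List.map_cons, List.prod_cons, mul_one, div_eq_mul_inv, mul_inv, one_mul, neg_pow (exp ℓ) k]
  ring

theorem Gamma_one_half_eq_sqrt_pi : Gamma (1 / 2) = (Real.sqrt Real.pi : ℂ) := by
  have h := Gamma_mul_Gamma_add_half (1 / 2)
  have e1 : (1 / 2 : ℂ) + 1 / 2 = 1 := by norm_num
  have e2 : (2 : ℂ) * (1 / 2) = 1 := by norm_num
  rw [e1, e2, Gamma_one, sub_self, cpow_zero] at h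
  simpa using h

theorem Gamma_three_halves : Gamma (3 / 2) = (Real.sqrt Real.pi : ℂ) / 2 := by
  have h := Gamma_add_one (1 / 2) (by norm_num)
  rw [Gamma_one_half_eq_sqrt_pi] at h
  norm_num at h
  rw [h]
  ring

/-- The parameters differ by `ν`, `ν + 1/2` and `1/2`, so the poles are simple exactly when `2ν` is
not an integer. -/
theorem meijerG_imaginary_quadratic {ν y : ℂ} (hν : ∀ n : ℤ, 2 * ν ≠ n) (hy : y ≠ 0) :
    meijerG [-ν / 2, ν / 2, (1 + ν) / 2] [(1 - ν) / 2, ν / 2, (1 + ν) / 2]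
        (2 * log (y / 4)) =
      (Real.sqrt Real.pi : ℂ) / sin (2 * Real.pi * ν) *
        ((2 : ℂ) ^ (1 - 4 * ν) / Gamma (1 - 2 * ν) ^ 2 * (y / 4) ^ (-ν) *
            hypergeometricPFQ [] [1 - ν, 1 - ν, 1 / 2 - ν, 1 / 2 - ν, 1 / 2] (-(y ^ 2 / 16))
          - (2 : ℂ) ^ (1 + 2 * ν) * cos (Real.pi * ν) / Gamma (1 + 2 * ν) * (y / 4) ^ ν *
            hypergeometricPFQ [] [1 + ν, 1 / 2 + ν, 1 / 2, 1 / 2, 1] (-(y ^ 2 / 16))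
          + (2 : ℂ) ^ (4 + 2 * ν) * sin (Real.pi * ν) / Gamma (2 + 2 * ν) * (y / 4) ^ (1 + ν) *
            hypergeometricPFQ [] [3 / 2 + ν, 1 + ν, 3 / 2, 3 / 2, 1] (-(y ^ 2 / 16))) := by
  have hy4 : y / 4 ≠ 0 := div_ne_zero hy (by norm_num)
  have hexp : exp (2 * log (y / 4)) = y ^ 2 / 16 := by
    rw [two_mul, Complex.exp_add, Complex.exp_log hy4]
    ring
  have hpow (w : ℂ) : exp (w / 2 * (2 * log (y / 4))) = (y / 4) ^ w := by
    rw [cpow_def_of_ne_zero hy4]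
    congr 1
    ring
  have s1 : sin (Real.pi * ν) ≠ 0 := sin_pi_mul_ne_zero_of_forall_ne fun k hk =>
    hν (2 * k) (by rw [hk]; push_cast; ring)
  have s2 : sin (Real.pi * (ν + 1 / 2)) ≠ 0 := sin_pi_mul_ne_zero_of_forall_ne fun k hk =>
    hν (2 * k - 1) (by push_cast; linear_combination 2 * hk)
  have s3 : sin (Real.pi * (ν + 1 / 2)) = cos (Real.pi * ν) := by
    rw [← Complex.sin_add_pi_div_two]
    congr 1
    ring
  rw [s3] at s2
  have g1 (m : ℕ) : 1 - ν ≠ -m := fun h => hν (2 * (m + 1)) (by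
    push_cast
    linear_combination -2 * h)
  have g2 (m : ℕ) : 1 / 2 - ν ≠ -m := fun h => hν (2 * m + 1) (by
    push_cast
    linear_combination -2 * h)
  have g3 (m : ℕ) : 1 + ν ≠ -m := fun h => hν (-2 * (m + 1)) (by
    push_cast
    linear_combination 2 * h)
  have g4 (m : ℕ) : 1 / 2 + ν ≠ -m := fun h => hν (-2 * m - 1) (by
    push_cast
    linear_combination 2 * h)
  have g5 (m : ℕ) : 3 / 2 + ν ≠ -m := fun h => hν (-2 * m - 3) (by
    push_cast
    linear_combination 2 * h)
  have g9 {w : ℂ} (hw : 0 < w.re) (m : ℕ) : w ≠ -m := by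
    rintro rfl
    have : (0 : ℝ) ≤ m := m.cast_nonneg
    simp at hw
    linarith
  have g6 := g9 (w := 1 / 2) (by norm_num)
  have g7 := g9 (w := 3 / 2) (by norm_num)
  have g8 := g9 (w := 1) (by norm_num)
  have t1 : ν / 2 - -ν / 2 = ν := by ring
  have t2 : (1 + ν) / 2 - -ν / 2 = ν + 1 / 2 := by ring
  have t3 : (1 + ν) / 2 - ν / 2 = 1 / 2 := by ring
  have t4 : sin (Real.pi * (1 / 2)) = 1 := by
    rw [mul_one_div, Complex.sin_pi_div_two]
  rw [meijerG_three (by rwa [t1]) (by rwa [t2, s3]) (by rw [t3, t4]; exact one_ne_zero), t1, t2, t3,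
    t4, s3]
  have r1 (k : ℂ) : 1 - ν / 2 + (-ν / 2 + k) = 1 - ν + k := by ring
  have r2 (k : ℂ) : 1 - (1 + ν) / 2 + (-ν / 2 + k) = 1 / 2 - ν + k := by ring
  have r3 (k : ℂ) : 1 - (1 - ν) / 2 + (-ν / 2 + k) = 1 / 2 + k := by ring
  have r4 (k : ℂ) : 1 - -ν / 2 + (ν / 2 + k) = 1 + ν + k := by ring
  have r5 (k : ℂ) : 1 - (1 + ν) / 2 + (ν / 2 + k) = 1 / 2 + k := by ring
  have r6 (k : ℂ) : 1 - (1 - ν) / 2 + (ν / 2 + k) = 1 / 2 + ν + k := by ring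
  have r7 (k : ℂ) : 1 - ν / 2 + (ν / 2 + k) = 1 + k := by ring
  have r8 (k : ℂ) : 1 - -ν / 2 + ((1 + ν) / 2 + k) = 3 / 2 + ν + k := by ring
  have r9 (k : ℂ) : 1 - ν / 2 + ((1 + ν) / 2 + k) = 3 / 2 + k := by ring
  have r10 (k : ℂ) : 1 - (1 - ν) / 2 + ((1 + ν) / 2 + k) = 1 + ν + k := by ring
  have r11 (k : ℂ) : 1 - (1 + ν) / 2 + ((1 + ν) / 2 + k) = 1 + k := by ring
  simp only [r1, r2, r3, r4, r5, r6, r7, r8, r9, r10, r11]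
  rw [tsum_prod_Gamma_inv_eq_hypergeometricPFQ (p := -ν / 2) (ℓ := 2 * log (y / 4))
      g1 g1 g2 g2 g6 (fun k => by ring),
    tsum_prod_Gamma_inv_eq_hypergeometricPFQ (p := ν / 2) (ℓ := 2 * log (y / 4))
      g3 g4 g6 g6 g8 (fun k => by ring),
    tsum_prod_Gamma_inv_eq_hypergeometricPFQ (p := (1 + ν) / 2) (ℓ := 2 * log (y / 4))
      g5 g3 g7 g7 g8 (fun k => by ring), hpow, hpow, hpow, hexp]
  -- Duplication merges the gamma factors of each residue series into `Γ(1 - 2ν)²`, `Γ(1 + 2ν)` and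
  -- `Γ(2 + 2ν)`; the powers of two come from here.
  have d1 := Gamma_mul_Gamma_add_half (1 / 2 - ν)
  have d2 := Gamma_mul_Gamma_add_half (1 / 2 + ν)
  have d3 := Gamma_mul_Gamma_add_half (1 + ν)
  have u1 : 1 / 2 - ν + 1 / 2 = 1 - ν := by ring
  have u2 : 1 / 2 + ν + 1 / 2 = 1 + ν := by ring
  have u3 : 1 + ν + 1 / 2 = 3 / 2 + ν := by ring
  have v1 : 2 * (1 / 2 - ν) = 1 - 2 * ν := by ring
  have v2 : 2 * (1 / 2 + ν) = 1 + 2 * ν := by ring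
  have v3 : 2 * (1 + ν) = 2 + 2 * ν := by ring
  rw [u1, v1] at d1
  rw [u2, v2] at d2
  rw [u3, v3] at d3
  have h2 : (2 : ℂ) ≠ 0 := two_ne_zero
  have hX : (2 : ℂ) ^ ν ≠ 0 := by simp [cpow_eq_zero_iff]
  have p0 : (2 : ℂ) ^ (2 * ν) = (2 ^ ν) ^ 2 := cpow_ofNat_mul 2 2 ν
  have p4 : (2 : ℂ) ^ (4 * ν) = (2 ^ ν) ^ 4 := cpow_ofNat_mul 2 4 ν
  have w1 : 1 - (1 - 2 * ν) = 2 * ν := by ring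
  have w2 : 1 - (1 + 2 * ν) = -(2 * ν) := by ring
  have w3 : 1 - (2 + 2 * ν) = -1 + -(2 * ν) := by ring
  rw [w1, p0] at d1
  rw [w2, cpow_neg, p0] at d2
  rw [w3, cpow_add _ _ h2, cpow_neg, cpow_neg, p0, cpow_one] at d3
  have p5 : (2 : ℂ) ^ (4 : ℂ) = 16 := by
    rw [show (4 : ℂ) = ((4 : ℕ) : ℂ) by norm_num, cpow_natCast]
    norm_num
  have hpi : (Real.pi : ℂ) = (Real.sqrt Real.pi : ℂ) ^ 2 := by
    rw [← ofReal_pow, Real.sq_sqrt Real.pi_pos.le]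
  have hsp : (Real.sqrt Real.pi : ℂ) ≠ 0 := ofReal_ne_zero.2 (Real.sqrt_pos.2 Real.pi_pos).ne'
  have hs2 : sin (2 * Real.pi * ν) = 2 * sin (Real.pi * ν) * cos (Real.pi * ν) := by
    rw [← Complex.sin_two_mul, mul_assoc]
  have k1 := Gamma_ne_zero g1
  have k2 := Gamma_ne_zero g2
  have k3 := Gamma_ne_zero g3
  have k4 := Gamma_ne_zero g4
  have k5 := Gamma_ne_zero g5
  have D1 : Gamma (1 - 2 * ν) = Gamma (1 / 2 - ν) * Gamma (1 - ν) /
      ((2 ^ ν) ^ 2 * (Real.sqrt Real.pi : ℂ)) := by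
    rw [d1]
    field_simp
  have D2 : Gamma (1 + 2 * ν) = Gamma (1 / 2 + ν) * Gamma (1 + ν) * (2 ^ ν) ^ 2 /
      (Real.sqrt Real.pi : ℂ) := by
    rw [d2]
    field_simp
  have D3 : Gamma (2 + 2 * ν) = Gamma (1 + ν) * Gamma (3 / 2 + ν) * (2 ^ ν) ^ 2 * 2 /
      (Real.sqrt Real.pi : ℂ) := by
    rw [d3]
    field_simp
  rw [D1, D2, D3, Gamma_one, Gamma_one_half_eq_sqrt_pi, Gamma_three_halves,
    cpow_sub _ _ h2, cpow_add _ _ h2, cpow_add _ _ h2, cpow_one, p0, p4, p5, hs2]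
  clear D1 D2 D3 d1 d2 d3 p0 p4 hs2 hpow hexp hν
  -- What remains is a rational identity, once the transcendental quantities are treated as
  -- independent symbols and `π` as the square of `√π`.
  generalize hypergeometricPFQ [] [1 - ν, 1 - ν, 1 / 2 - ν, 1 / 2 - ν, 1 / 2] _ = F₁
  generalize hypergeometricPFQ [] [1 + ν, 1 / 2 + ν, 1 / 2, 1 / 2, 1] _ = F₂
  generalize hypergeometricPFQ [] [3 / 2 + ν, 1 + ν, 3 / 2, 3 / 2, 1] _ = F₃
  generalize (y / 4) ^ (-ν) = Y₁
  generalize (y / 4) ^ ν = Y₂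
  generalize (y / 4) ^ (1 + ν) = Y₃
  generalize (2 : ℂ) ^ ν = X at *
  generalize Gamma (1 - ν) = G₁ at *
  generalize Gamma (1 / 2 - ν) = G₂ at *
  generalize Gamma (1 + ν) = G₃ at *
  generalize Gamma (1 / 2 + ν) = G₄ at *
  generalize Gamma (3 / 2 + ν) = G₅ at *
  generalize sin (Real.pi * ν) = S at *
  generalize cos (Real.pi * ν) = C at *
  rw [hpi]
  generalize (Real.sqrt Real.pi : ℂ) = P at *
  field_simp
  ring

/-! ### Bessel functions at `2√y` as functions of the order -/

/-- The common terms of the Bessel functions `J_μ` (`ε = -1`) and `I_μ` (`ε = 1`) at `2 √y`, where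
`L = log y`. -/
noncomputable def besselTerm (ε L μ : ℂ) (m : ℕ) : ℂ :=
  ε ^ m * exp ((m + μ / 2) * L) * ((m.factorial : ℂ)⁻¹ * (Gamma (m + 1 + μ))⁻¹)

/-- The common power series of the Bessel functions `J_μ` (`ε = -1`) and `I_μ` (`ε = 1`) at `2 √y`,
where `L = log y`. -/
noncomputable def besselSeries (ε L μ : ℂ) : ℂ := ∑' m : ℕ, besselTerm ε L μ m

/-- A majorant uniform on bounded sets of orders, which makes the series holomorphic in the order.
-/
theorem exists_norm_besselTerm_le {ε : ℂ} (hε : ‖ε‖ ≤ 1) (L : ℂ) (R : ℝ) :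
    ∃ u : ℕ → ℝ, Summable u ∧ ∀ m μ, ‖μ‖ ≤ R → ‖besselTerm ε L μ m‖ ≤ u m := by
  obtain ⟨C, hC0, hC⟩ := exists_norm_Gamma_inv_add_le 0 0 0 R
  refine ⟨fun m => Real.exp (R / 2 * ‖L‖) * C * (Real.exp L.re ^ m / m.factorial),
    (Real.summable_pow_div_factorial _).mul_left _, fun m μ hμ => ?_⟩
  have h1 := hC μ (m + 1) hμ (by simp; positivity) (by simp)
  have h2 : ‖exp ((m + μ / 2) * L)‖ ≤ Real.exp L.re ^ m * Real.exp (R / 2 * ‖L‖) := by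
    rw [← Real.exp_nat_mul, ← Real.exp_add, norm_exp]
    gcongr
    have h3 : (μ / 2 * L).re ≤ R / 2 * ‖L‖ := by
      refine (re_le_norm _).trans ?_
      rw [norm_mul, norm_div, Complex.norm_ofNat]
      gcongr
    rw [add_mul, add_re]
    simpa using h3
  rw [zero_mul, neg_zero, Real.exp_zero, mul_one, add_comm μ] at h1
  rw [besselTerm, norm_mul, norm_mul, norm_mul, norm_pow, norm_inv, norm_natCast]
  calc _ ≤ 1 * (Real.exp L.re ^ m * Real.exp (R / 2 * ‖L‖)) * ((m.factorial : ℝ)⁻¹ * C) := by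
        gcongr
        exact pow_le_one₀ (norm_nonneg _) hε
    _ = _ := by
        field_simp

theorem summable_besselTerm {ε : ℂ} (hε : ‖ε‖ ≤ 1) (L μ : ℂ) : Summable (besselTerm ε L μ) := by
  obtain ⟨u, hu, h⟩ := exists_norm_besselTerm_le hε L ‖μ‖
  exact Summable.of_norm_bounded hu fun m => h m μ le_rfl

/-- The Bessel functions are entire in the order. -/
theorem differentiable_besselSeries {ε : ℂ} (hε : ‖ε‖ ≤ 1) (L : ℂ) :
    Differentiable ℂ (besselSeries ε L) := by
  intro μ
  obtain ⟨u, hu, h⟩ := exists_norm_besselTerm_le hε L (‖μ‖ + 1)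
  have hd := differentiableOn_tsum_of_summable_norm (F := fun m μ => besselTerm ε L μ m) hu
    (U := Metric.ball 0 (‖μ‖ + 1)) (fun m => Differentiable.differentiableOn ?_)
    Metric.isOpen_ball fun m w hw => h m w (by simpa using (mem_ball_zero_iff.1 hw).le)
  · exact hd.differentiableAt (Metric.isOpen_ball.mem_nhds (by simp))
  · exact Differentiable.mul (by fun_prop) ((differentiable_Gamma_inv_add _).const_mul _)

/-- The first `n` terms vanish at the poles of the gamma function; shifting the index by `n` gives
the rest. -/
theorem besselSeries_neg_natCast {ε : ℂ} (hε : ‖ε‖ ≤ 1) (L : ℂ) (n : ℕ) :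
    besselSeries ε L (-n) = ε ^ n * besselSeries ε L n := by
  rw [besselSeries, ← (summable_besselTerm hε L (-n)).sum_add_tsum_nat_add n, besselSeries,
    ← tsum_mul_left, Finset.sum_eq_zero, zero_add]
  · refine tsum_congr fun j => ?_
    have e1 : ((j + n : ℕ) : ℂ) + 1 + -n = j + 1 := by
      push_cast
      ring
    have e2 : (j : ℂ) + 1 + n = ((j + n : ℕ) : ℂ) + 1 := by
      push_cast
      ring
    have e3 : ((j + n : ℕ) : ℂ) + -n / 2 = j + n / 2 := by
      push_cast
      ring
    rw [besselTerm, besselTerm, e1, e2, e3, Gamma_nat_eq_factorial, Gamma_nat_eq_factorial, pow_add]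
    ring
  · intro m hm
    rw [Finset.mem_range] at hm
    obtain ⟨k, rfl⟩ := Nat.exists_eq_add_of_lt hm
    have : (m : ℂ) + 1 + -((m + k + 1 : ℕ) : ℂ) = -k := by
      push_cast
      ring
    rw [besselTerm, this, Gamma_neg_nat_eq_zero]
    simp

theorem besselSeries_neg_intCast {ε : ℂ} (hε : ε * ε = 1) (L : ℂ) (n : ℤ) :
    besselSeries ε L (-n) = ε ^ n * besselSeries ε L n := by
  have h1 : ‖ε‖ ≤ 1 := by
    have := congrArg norm hε
    rw [norm_mul, norm_one] at this
    nlinarith [norm_nonneg ε]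
  obtain ⟨k, rfl | rfl⟩ := n.eq_nat_or_neg
  · simpa using besselSeries_neg_natCast h1 L k
  · have h := besselSeries_neg_natCast h1 L k
    have h2 : ε ^ k * ε ^ k = 1 := by rw [← mul_pow, hε, one_pow]
    have h3 : (ε ^ k)⁻¹ = ε ^ k := inv_eq_of_mul_eq_one_left h2
    rw [Int.cast_neg, neg_neg, Int.cast_natCast, h, zpow_neg, zpow_natCast, h3, ← mul_assoc, h2,
      one_mul]

theorem log_cpow_one_half (y : ℂ) (hy : y ≠ 0) : log (y ^ (1 / 2 : ℂ)) = log y / 2 := by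
  rw [cpow_def_of_ne_zero hy, log_exp]
  · ring
  · have := neg_pi_lt_arg y
    simp [log_im]
    linarith [Real.pi_pos]
  · have := arg_le_pi y
    simp [log_im]
    linarith [Real.pi_pos]

theorem cpow_one_half_ne_zero {y : ℂ} (hy : y ≠ 0) : y ^ (1 / 2 : ℂ) ≠ 0 := by
  simp [cpow_eq_zero_iff, hy]

theorem besselJ_two_mul_sqrt {y : ℂ} (hy : y ≠ 0) (μ : ℂ) :
    besselJ μ (2 * y ^ (1 / 2 : ℂ)) = besselSeries (-1) (log y) μ := by
  refine tsum_congr fun m => ?_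
  rw [mul_div_cancel_left₀ _ two_ne_zero, cpow_def_of_ne_zero (cpow_one_half_ne_zero hy),
    log_cpow_one_half y hy, besselTerm, div_eq_mul_inv, mul_inv]
  ring_nf

/-- The argument of `2√y` lies in `(-π/2, π/2]`, so the first branch of `besselI` applies, and a
further rotation by `π/2` stays in `(-π, π]`. All powers are therefore governed by the single
logarithm `log y`. -/
theorem besselI_two_mul_sqrt {y : ℂ} (hy : y ≠ 0) (μ : ℂ) :
    besselI μ (2 * y ^ (1 / 2 : ℂ)) = besselSeries 1 (log y) μ := by
  have hw := cpow_one_half_ne_zero hy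
  have hlog := log_cpow_one_half y hy
  set w := y ^ (1 / 2 : ℂ) with hwdef
  have harg : w.arg = y.arg / 2 := by
    rw [← log_im, hlog]
    simp [log_im]
  have h2 : (2 * w).arg = y.arg / 2 := by
    rw [← harg]
    exact_mod_cast arg_real_mul w (r := 2) two_pos
  have hle := arg_le_pi y
  have hlt := neg_pi_lt_arg y
  rw [besselI, if_pos (by rw [h2]; linarith), besselJ, besselSeries, ← tsum_mul_left]
  refine tsum_congr fun m => ?_
  have e1 : exp (1 / 2 * Real.pi * I) * (2 * w) / 2 = exp (1 / 2 * Real.pi * I + log y / 2) := by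
    rw [Complex.exp_add, ← hlog, Complex.exp_log hw]
    ring
  have e2 : log (exp (1 / 2 * Real.pi * I + log y / 2)) = 1 / 2 * Real.pi * I + log y / 2 := by
    apply log_exp
    · simp [log_im]
      linarith [Real.pi_pos]
    · simp [log_im]
      linarith [Real.pi_pos]
  have e3 : exp (-(1 / 2) * Real.pi * μ * I) *
      exp ((1 / 2 * Real.pi * I + log y / 2) * (2 * m + μ)) =
      (-1) ^ m * exp ((m + μ / 2) * log y) := by
    rw [← exp_pi_mul_I, ← Complex.exp_nat_mul, ← Complex.exp_add, ← Complex.exp_add]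
    ring_nf
  have e4 : ((-1 : ℂ) ^ m) * (-1) ^ m = 1 := by
    rw [← mul_pow]
    simp
  rw [e1, cpow_def_of_ne_zero (exp_ne_zero _), e2, besselTerm, one_pow,
    div_eq_mul_inv ((-1) ^ m * _), mul_inv]
  linear_combination ((-1) ^ m * ((m.factorial : ℂ)⁻¹ * (Gamma (m + 1 + μ))⁻¹)) * e3 +
    (exp ((m + μ / 2) * log y) * ((m.factorial : ℂ)⁻¹ * (Gamma (m + 1 + μ))⁻¹)) * e4

theorem besselYQuot_two_mul_sqrt {y : ℂ} (hy : y ≠ 0) (μ : ℂ) :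
    besselYQuot μ (2 * y ^ (1 / 2 : ℂ)) =
      (besselSeries (-1) (log y) μ * cos (Real.pi * μ) - besselSeries (-1) (log y) (-μ)) /
        sin (Real.pi * μ) := by
  rw [besselYQuot, besselJ_two_mul_sqrt hy, besselJ_two_mul_sqrt hy]

theorem besselKQuot_two_mul_sqrt {y : ℂ} (hy : y ≠ 0) (μ : ℂ) :
    besselKQuot μ (2 * y ^ (1 / 2 : ℂ)) =
      Real.pi / 2 * ((besselSeries 1 (log y) (-μ) - besselSeries 1 (log y) μ) /
        sin (Real.pi * μ)) := by
  rw [besselKQuot, besselI_two_mul_sqrt hy, besselI_two_mul_sqrt hy, mul_comm μ]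

theorem tendsto_div_of_hasDerivAt {f g : ℂ → ℂ} {f' g' a : ℂ} (hf : HasDerivAt f f' a)
    (hg : HasDerivAt g g' a) (hfa : f a = 0) (hga : g a = 0) (hg' : g' ≠ 0) :
    Tendsto (fun z => f z / g z) (𝓝[≠] a) (𝓝 (f' / g')) := by
  refine (hf.tendsto_slope.div hg.tendsto_slope hg').congr' ?_
  filter_upwards [self_mem_nhdsWithin] with z hz
  rw [Pi.div_apply, slope_def_field, slope_def_field, hfa, hga, sub_zero, sub_zero,
    div_div_div_cancel_right₀ (sub_ne_zero.2 hz)]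

theorem cos_intCast_mul_pi (n : ℤ) : cos (Real.pi * n) = (-1) ^ n := by
  have h := Complex.cos_antiperiodic.add_int_mul_eq (x := 0) n
  rw [zero_add, Complex.cos_zero, mul_one, Int.cast_negOnePow] at h
  rw [mul_comm, h]

theorem sin_intCast_mul_pi (n : ℤ) : sin (Real.pi * n) = 0 := by
  rw [mul_comm, Complex.sin_int_mul_pi]

theorem hasDerivAt_sin_pi_mul (a : ℂ) :
    HasDerivAt (fun μ => sin (Real.pi * μ)) (cos (Real.pi * a) * (Real.pi * 1)) a :=
  ((hasDerivAt_id a).const_mul (Real.pi : ℂ)).csin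

/-- The zero of the sine is simple, so the quotient of derivatives is the limit. Existence is
enough: `besselY` and `besselK` at integers are defined as this limit. -/
theorem exists_tendsto_div_sin_pi_mul {f : ℂ → ℂ} (hf : Differentiable ℂ f) {n : ℤ}
    (h : f n = 0) :
    ∃ l, Tendsto (fun μ => f μ / sin (Real.pi * μ)) (𝓝[≠] (n : ℂ)) (𝓝 l) :=
  ⟨_, tendsto_div_of_hasDerivAt (hf n).hasDerivAt (hasDerivAt_sin_pi_mul n) h
    (sin_intCast_mul_pi n) (by
      rw [cos_intCast_mul_pi]
      exact mul_ne_zero (zpow_ne_zero _ (by norm_num))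
        (mul_ne_zero (ofReal_ne_zero.2 Real.pi_ne_zero) one_ne_zero))⟩

theorem tendsto_besselYQuot {y : ℂ} (hy : y ≠ 0) (n : ℤ) :
    Tendsto (fun μ => besselYQuot μ (2 * y ^ (1 / 2 : ℂ))) (𝓝[≠] (n : ℂ))
      (𝓝 (besselY n (2 * y ^ (1 / 2 : ℂ)))) := by
  have hd := differentiable_besselSeries (ε := -1) (by simp) (log y)
  have hdn := hd.comp differentiable_neg
  obtain ⟨l, hl⟩ := exists_tendsto_div_sin_pi_mul (n := n)
    (f := fun μ => besselSeries (-1) (log y) μ * cos (Real.pi * μ) - besselSeries (-1) (log y) (-μ))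
    ((hd.mul (by fun_prop)).sub hdn) (by
      rw [besselSeries_neg_intCast (by norm_num), cos_intCast_mul_pi]
      ring)
  simp only [← besselYQuot_two_mul_sqrt hy] at hl
  rw [besselY, if_pos ⟨n, rfl⟩, hl.limUnder_eq]
  exact hl

theorem tendsto_besselKQuot {y : ℂ} (hy : y ≠ 0) (n : ℤ) :
    Tendsto (fun μ => besselKQuot μ (2 * y ^ (1 / 2 : ℂ))) (𝓝[≠] (n : ℂ))
      (𝓝 (besselK n (2 * y ^ (1 / 2 : ℂ)))) := by
  have hd := differentiable_besselSeries (ε := 1) (by simp) (log y)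
  have hdn := hd.comp differentiable_neg
  obtain ⟨l, hl⟩ := exists_tendsto_div_sin_pi_mul (n := n)
    (f := fun μ => besselSeries 1 (log y) (-μ) - besselSeries 1 (log y) μ) (hdn.sub hd) (by
      rw [besselSeries_neg_intCast (by norm_num)]
      simp)
  replace hl := hl.const_mul (Real.pi / 2 : ℂ)
  simp only [← besselKQuot_two_mul_sqrt hy] at hl
  rw [besselK, if_pos ⟨n, rfl⟩, hl.limUnder_eq]
  exact hl

/-! ### The rational field for non-integral `2ν` -/

theorem besselSeries_add_besselSeries_neg (L μ : ℂ) :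
    besselSeries 1 L μ + besselSeries (-1) L μ = 2 * ∑' k : ℕ, besselTerm 1 L μ (2 * k) := by
  have h1 := summable_besselTerm (ε := 1) (by simp) L μ
  have h2 := summable_besselTerm (ε := -1) (by simp) L μ
  have i0 : Function.Injective fun k : ℕ => 2 * k := fun a b h => by simpa using h
  have i1 : Function.Injective fun k : ℕ => 2 * k + 1 := fun a b h => by simpa using h
  rw [besselSeries, besselSeries, ← tsum_even_add_odd (h1.comp_injective i0)
    (h1.comp_injective i1), ← tsum_even_add_odd (h2.comp_injective i0) (h2.comp_injective i1)]
  have e0 (k : ℕ) : besselTerm (-1) L μ (2 * k) = besselTerm 1 L μ (2 * k) := by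
    simp [besselTerm, pow_mul]
  have e1 (k : ℕ) : besselTerm (-1) L μ (2 * k + 1) = -besselTerm 1 L μ (2 * k + 1) := by
    simp [besselTerm, pow_succ, pow_mul]
  simp only [e0, e1, tsum_neg]
  ring

theorem inv_Gamma_mul_inv_Gamma_add_half (μ : ℂ) (k : ℕ) :
    (Gamma (1 / 2 + μ + k))⁻¹ * (Gamma (1 + μ + k))⁻¹ =
      (Gamma (2 * k + 1 + 2 * μ))⁻¹ * exp (2 * (μ + k) * Real.log 2) *
        (Real.sqrt Real.pi : ℂ)⁻¹ := by
  have h := Gamma_mul_Gamma_add_half (1 / 2 + μ + k)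
  have e1 : 1 / 2 + μ + k + 1 / 2 = 1 + μ + (k : ℂ) := by ring
  have e2 : 2 * (1 / 2 + μ + k) = 2 * k + 1 + 2 * μ := by ring
  have e3 : (2 : ℂ) ^ (1 - (2 * k + 1 + 2 * μ)) = (exp (2 * (μ + k) * Real.log 2))⁻¹ := by
    rw [cpow_def_of_ne_zero two_ne_zero, ← Complex.exp_neg, ofReal_log zero_le_two, ofReal_ofNat]
    ring_nf
  rw [e1, e2, e3] at h
  rw [← mul_inv, h, mul_inv, mul_inv, inv_inv]

theorem log_div_four {y : ℂ} (hy : y ≠ 0) : log (y / 4) = log y - 2 * Real.log 2 := by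
  have h := log_mul_ofReal (1 / 4) (by norm_num) y hy
  have e : Real.log (1 / 4) = -(2 * Real.log 2) := by
    rw [one_div, Real.log_inv, show (4 : ℝ) = 2 ^ 2 by norm_num, Real.log_pow]
    push_cast
    ring
  rw [e] at h
  push_cast at h
  rw [show y / 4 = y * (1 / 4) by ring, h]
  ring

/-- Duplication is used twice: at `μ` it produces `Γ(2k + 1 + 2μ)`, and at `0` it turns `k! Γ(k +
1/2)` into `(2k)!`. The resulting powers of two cancel the 4 in `y/4`. -/
theorem residue_eq_besselTerm {y : ℂ} (hy : y ≠ 0) (μ : ℂ) (k : ℕ) :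
    (k.factorial : ℂ)⁻¹ * ((Gamma (1 + μ + k))⁻¹ * (Gamma (1 / 2 + μ + k))⁻¹ *
      (Gamma (1 / 2 + k))⁻¹ * exp ((μ / 2 + k) * (2 * log (y / 4)))) =
      (Real.pi : ℂ)⁻¹ * besselTerm 1 (log y) (2 * μ) (2 * k) := by
  have h1 := inv_Gamma_mul_inv_Gamma_add_half μ k
  have h2 := inv_Gamma_mul_inv_Gamma_add_half 0 k
  have e1 : (1 : ℂ) + 0 + k = k + 1 := by ring
  have e2 : (2 * (k : ℂ) + 1 + 2 * 0) = ((2 * k : ℕ) : ℂ) + 1 := by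
    push_cast
    ring
  rw [e1, e2, Gamma_nat_eq_factorial, Gamma_nat_eq_factorial, add_zero] at h2
  have hpi : (Real.pi : ℂ)⁻¹ = (Real.sqrt Real.pi : ℂ)⁻¹ * (Real.sqrt Real.pi : ℂ)⁻¹ := by
    rw [← mul_inv, ← ofReal_mul, Real.mul_self_sqrt Real.pi_pos.le]
  have hexp : exp (2 * (μ + k) * Real.log 2) * exp (2 * (0 + k) * Real.log 2) *
      exp ((μ / 2 + k) * (2 * log (y / 4))) =
      exp (((2 * k : ℕ) + 2 * μ / 2) * log y) := by
    rw [log_div_four hy, ← Complex.exp_add, ← Complex.exp_add]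
    push_cast
    ring_nf
  rw [besselTerm, ← hexp, one_pow, hpi]
  have e3 : ((2 * k : ℕ) : ℂ) + 1 + 2 * μ = 2 * k + 1 + 2 * μ := by push_cast; ring
  rw [e3]
  linear_combination ((k.factorial : ℂ)⁻¹ * (Gamma (1 / 2 + k))⁻¹ *
    exp ((μ / 2 + k) * (2 * log (y / 4)))) * h1 +
    ((Gamma (2 * k + 1 + 2 * μ))⁻¹ * exp (2 * (μ + k) * Real.log 2) *
        (Real.sqrt Real.pi : ℂ)⁻¹ * exp ((μ / 2 + k) * (2 * log (y / 4)))) * h2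

theorem meijerG_rational {ν y : ℂ} (hν : ∀ n : ℤ, 2 * ν ≠ n) (hy : y ≠ 0) :
    meijerG [-ν / 2, ν / 2] [(1 - ν) / 2, (1 + ν) / 2] (2 * log (y / 4)) =
      cos (Real.pi * ν) * (2 / Real.pi * besselKQuot (2 * ν) (2 * y ^ (1 / 2 : ℂ))
          - besselYQuot (2 * ν) (2 * y ^ (1 / 2 : ℂ)))
        - sin (Real.pi * ν) * besselJ (2 * ν) (2 * y ^ (1 / 2 : ℂ)) := by
  have hpi := ofReal_ne_zero.2 Real.pi_ne_zero
  have s1 : sin (Real.pi * ν) ≠ 0 := sin_pi_mul_ne_zero_of_forall_ne fun k hk =>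
    hν (2 * k) (by rw [hk]; push_cast; ring)
  have s2 : sin (Real.pi * (2 * ν)) ≠ 0 := sin_pi_mul_ne_zero_of_forall_ne hν
  have s3 : sin (Real.pi * (2 * ν)) = 2 * sin (Real.pi * ν) * cos (Real.pi * ν) := by
    rw [← Complex.sin_two_mul]
    ring_nf
  have s4 : cos (Real.pi * (2 * ν)) = 2 * cos (Real.pi * ν) ^ 2 - 1 := by
    rw [← Complex.cos_two_mul]
    ring_nf
  have s5 : cos (Real.pi * ν) ≠ 0 := fun h => s2 (by rw [s3, h, mul_zero])
  have t1 : ν / 2 - -ν / 2 = ν := by ring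
  rw [meijerG_two (by rwa [t1]), t1]
  have r1 (k : ℂ) : 1 - ν / 2 + (-ν / 2 + k) = 1 + -ν + k := by ring
  have r2 (k : ℂ) : 1 - (1 - ν) / 2 + (-ν / 2 + k) = 1 / 2 + k := by ring
  have r3 (k : ℂ) : 1 - (1 + ν) / 2 + (-ν / 2 + k) = 1 / 2 + -ν + k := by ring
  have r4 (k : ℂ) : 1 - -ν / 2 + (ν / 2 + k) = 1 + ν + k := by ring
  have r5 (k : ℂ) : 1 - (1 - ν) / 2 + (ν / 2 + k) = 1 / 2 + ν + k := by ring
  have r6 (k : ℂ) : 1 - (1 + ν) / 2 + (ν / 2 + k) = 1 / 2 + k := by ring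
  simp only [r1, r2, r3, r4, r5, r6]
  have f1 (k : ℕ) : (k.factorial : ℂ)⁻¹ * ((Gamma (1 + -ν + k))⁻¹ * (Gamma (1 / 2 + k))⁻¹ *
      (Gamma (1 / 2 + -ν + k))⁻¹ * exp ((-ν / 2 + k) * (2 * log (y / 4)))) =
      (Real.pi : ℂ)⁻¹ * besselTerm 1 (log y) (2 * -ν) (2 * k) := by
    rw [← residue_eq_besselTerm hy]
    ring
  rw [tsum_congr f1, tsum_congr fun k => residue_eq_besselTerm hy ν k, tsum_mul_left,
    tsum_mul_left, besselJ_two_mul_sqrt hy, besselYQuot_two_mul_sqrt hy,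
    besselKQuot_two_mul_sqrt hy]
  have h2 := besselSeries_add_besselSeries_neg (log y) (2 * ν)
  have h3 := besselSeries_add_besselSeries_neg (log y) (2 * -ν)
  rw [mul_neg] at h3 ⊢
  generalize ∑' k : ℕ, besselTerm 1 (log y) (2 * ν) (2 * k) = A at *
  generalize ∑' k : ℕ, besselTerm 1 (log y) (-(2 * ν)) (2 * k) = B at *
  obtain rfl : A = (besselSeries 1 (log y) (2 * ν) + besselSeries (-1) (log y) (2 * ν)) / 2 := by
    rw [h2]
    ring
  obtain rfl : B = (besselSeries 1 (log y) (-(2 * ν)) + besselSeries (-1) (log y) (-(2 * ν))) / 2 := by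
    rw [h3]
    ring
  have s6 := Complex.sin_sq_add_cos_sq (Real.pi * ν)
  rw [s3, s4]
  clear h2 h3
  generalize besselSeries 1 (log y) (2 * ν) = X₁
  generalize besselSeries 1 (log y) (-(2 * ν)) = X₂
  generalize besselSeries (-1) (log y) (2 * ν) = X₃
  generalize besselSeries (-1) (log y) (-(2 * ν)) = X₄
  field_simp
  -- Only the coefficient of `J_{2ν}` needs the Pythagorean identity, in the form `cos 2πν + 2 sin²
  -- πν = 1`.
  linear_combination (2 * X₃) * s6

/-! ### Continuity in `ν` and the case of integral `2ν` -/

/-- The abscissa of the loop varies with `ν`; the translation fixes the domain so that dominated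
convergence applies. -/
theorem integral_Ioi_eq_integral_Ioi_zero (f : ℝ → ℂ) (c : ℝ) :
    ∫ u in Ioi c, f u = ∫ u in Ioi (0 : ℝ), f (u + c) := by
  have h := (measurePreserving_add_right volume c).setIntegral_preimage_emb
    (measurableEmbedding_addRight c) f (Ioi c)
  rw [preimage_add_const_Ioi, sub_self] at h
  exact h.symm

/-- The integrand of the Meijer function for the rational field. -/
noncomputable def rationalIntegrand (ℓ ν s : ℂ) : ℂ :=
  meijerIntegrand [-ν / 2, ν / 2] [(1 - ν) / 2, (1 + ν) / 2] ℓ s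

theorem rationalIntegrand_eq (ℓ ν s : ℂ) : rationalIntegrand ℓ ν s =
    Gamma (-ν / 2 - s) * Gamma (ν / 2 - s) * ((Gamma (1 - (1 - ν) / 2 + s))⁻¹ *
      (Gamma (1 - (1 + ν) / 2 + s))⁻¹ * exp (s * ℓ)) := by
  simp [rationalIntegrand, meijerIntegrand, div_eq_mul_inv]
  ring

theorem continuousAt_rationalIntegrand (ℓ : ℂ) {ν s : ℂ} (h₁ : ∀ m : ℕ, -ν / 2 - s ≠ -m)
    (h₂ : ∀ m : ℕ, ν / 2 - s ≠ -m) :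
    ContinuousAt (fun z : ℂ × ℂ => rationalIntegrand ℓ z.1 z.2) (ν, s) := by
  simp only [rationalIntegrand_eq]
  have hr := differentiable_one_div_Gamma.continuous
  refine ContinuousAt.mul (ContinuousAt.mul ?_ ?_) (Continuous.continuousAt ?_)
  · exact ContinuousAt.comp (f := fun z : ℂ × ℂ => -z.1 / 2 - z.2) (g := Gamma)
      (differentiableAt_Gamma _ h₁).continuousAt (by fun_prop)
  · exact ContinuousAt.comp (f := fun z : ℂ × ℂ => z.1 / 2 - z.2) (g := Gamma)
      (differentiableAt_Gamma _ h₂).continuousAt (by fun_prop)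
  · exact ((hr.comp (by fun_prop : Continuous fun z : ℂ × ℂ => 1 - (1 - z.1) / 2 + z.2)).mul
      (hr.comp (by fun_prop : Continuous fun z : ℂ × ℂ => 1 - (1 + z.1) / 2 + z.2))).mul
      (by fun_prop)

/-- Reflection is applied to both numerator factors in turn, each at distance at least one from its
poles. No separation of the poles of the two factors is needed, so the bound persists at integral
`2ν`. -/
theorem norm_rationalIntegrand_le {ℓ ν s : ℂ} (h : |ν.im| / 2 + 1 ≤ |s.im|) :
    ‖rationalIntegrand ℓ ν s‖ ≤ ‖(([1 - -ν / 2, 1 - ν / 2, 1 - (1 - ν) / 2,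
      1 - (1 + ν) / 2] : List ℂ).map fun a => (Gamma (a + s))⁻¹).prod * exp (s * ℓ)‖ := by
  have key (σ : ℝ) (hσ : |σ| = 1) : 1 ≤ |σ * ν.im / 2 - s.im| := by
    have h1 := abs_sub_abs_le_abs_sub s.im (σ * ν.im / 2)
    rw [abs_div, abs_mul, hσ, one_mul, abs_two] at h1
    rw [abs_sub_comm]
    linarith
  have hp : 1 ≤ |(-ν / 2 - s).im| := by simpa using key (-1) (by simp)
  have hq : 1 ≤ |(ν / 2 - s).im| := by simpa using key 1 (by simp)
  set X := (Gamma (1 - (1 - ν) / 2 + s))⁻¹ * (Gamma (1 - (1 + ν) / 2 + s))⁻¹ * exp (s * ℓ)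
    with hX
  have e1 := norm_mul_Gamma_sub_le (E := fun s => Gamma (ν / 2 - s) * X) hp
  have e2 := norm_mul_Gamma_sub_le (E := fun s => (Gamma (1 - -ν / 2 + s))⁻¹ * X) hq
  calc ‖rationalIntegrand ℓ ν s‖ = ‖Gamma (ν / 2 - s) * X * Gamma (-ν / 2 - s)‖ := by
        rw [rationalIntegrand_eq, ← hX]
        ring_nf
    _ ≤ _ := e1
    _ = ‖(Gamma (1 - -ν / 2 + s))⁻¹ * X * Gamma (ν / 2 - s)‖ := by ring_nf
    _ ≤ _ := e2
    _ = _ := by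
      simp only [hX, List.map_cons, List.map_nil, List.prod_cons, List.prod_nil, mul_one]
      ring_nf

theorem ne_neg_natCast_of_abs_im {ν s : ℂ} (h : |ν.im| / 2 + 1 ≤ |s.im|) :
    (∀ m : ℕ, -ν / 2 - s ≠ -m) ∧ ∀ m : ℕ, ν / 2 - s ≠ -m := by
  constructor <;> intro m hm
  · have h1 : -ν.im / 2 - s.im = 0 := by simpa using congrArg im hm
    rw [show s.im = -(ν.im / 2) by linarith, abs_neg, abs_div, abs_two] at h
    linarith
  · have h1 : ν.im / 2 - s.im = 0 := by simpa using congrArg im hm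
    rw [show s.im = ν.im / 2 by linarith, abs_div, abs_two] at h
    linarith

theorem continuous_integral_Ioi_rationalIntegrand (ℓ : ℂ) {c y : ℂ → ℝ} (hc : Continuous c)
    (hy : Continuous y) (h : ∀ ν, |ν.im| / 2 + 1 ≤ |y ν|) :
    Continuous fun ν => ∫ u in Ioi (c ν), rationalIntegrand ℓ ν ((u : ℂ) + y ν * I) := by
  simp only [integral_Ioi_eq_integral_Ioi_zero _ (c _)]
  refine continuous_iff_continuousAt.2 fun ν₀ => ?_
  have hcont (ν : ℂ) (u : ℝ) : ContinuousAt (fun z : ℂ × ℂ => rationalIntegrand ℓ z.1 z.2)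
      (ν, ((u + c ν : ℝ) : ℂ) + y ν * I) := by
    have := ne_neg_natCast_of_abs_im (ν := ν) (s := ((u + c ν : ℝ) : ℂ) + y ν * I)
      (by simpa using h ν)
    exact continuousAt_rationalIntegrand ℓ this.1 this.2
  -- The margins allow for `ν` near `ν₀`: abscissa down by one, height up by one, and all four
  -- parameters `1 ± ν/2`, `1/2 ± ν/2` of norm at most `‖ν₀‖ + 2`.
  obtain ⟨C, hC0, hC⟩ := exists_norm_prod_Gamma_inv_mul_exp_le 3 (c ν₀ - 1) (|y ν₀| + 1)
    (‖ν₀‖ + 2) ℓ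
  refine continuousAt_of_dominated
    (bound := fun u => C * Real.exp (-(c ν₀ - 1)) * Real.exp (-u)) ?_ ?_ ?_ ?_
  · refine Eventually.of_forall fun ν => Continuous.aestronglyMeasurable ?_
    refine continuous_iff_continuousAt.2 fun u => ?_
    exact ContinuousAt.comp (f := fun u : ℝ => (ν, ((u + c ν : ℝ) : ℂ) + y ν * I)) (hcont ν u)
      (by fun_prop)
  · have n1 : ∀ᶠ ν in 𝓝 ν₀, ‖ν‖ < ‖ν₀‖ + 1 :=
      continuous_norm.continuousAt.eventually_lt_const (by linarith)
    have n2 : ∀ᶠ ν in 𝓝 ν₀, |y ν| < |y ν₀| + 1 :=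
      hy.abs.continuousAt.eventually_lt_const (by linarith)
    have n3 : ∀ᶠ ν in 𝓝 ν₀, c ν₀ - 1 < c ν :=
      hc.continuousAt.eventually_const_lt (by linarith)
    filter_upwards [n1, n2, n3] with ν h1 h2 h3
    refine (ae_restrict_iff' measurableSet_Ioi).2 (Eventually.of_forall fun u hu => ?_)
    have hu0 : 0 < u := hu
    have n4 : ‖ν / 2‖ ≤ ‖ν₀‖ + 1 := by
      rw [norm_div, Complex.norm_ofNat]
      linarith [norm_nonneg ν]
    refine (norm_rationalIntegrand_le (by simpa using h ν)).trans
      ((hC _ _ rfl ?_ ?_ ?_).trans ?_)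
    · have hb (σ τ : ℂ) (hσ : ‖σ‖ ≤ 1) (hτ : ‖τ‖ ≤ 1) : ‖σ + τ * (ν / 2)‖ ≤ ‖ν₀‖ + 2 := by
        refine (norm_add_le _ _).trans ?_
        rw [norm_mul]
        have : ‖τ‖ * ‖ν / 2‖ ≤ 1 * (‖ν₀‖ + 1) := by gcongr
        linarith
      intro a ha
      simp only [List.mem_cons, List.not_mem_nil, or_false] at ha
      rcases ha with rfl | rfl | rfl | rfl
      · convert hb 1 1 (by simp) (by simp) using 2
        ring
      · convert hb 1 (-1) (by simp) (by simp) using 2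
        ring
      · convert hb (1 / 2) 1 (by norm_num) (by simp) using 2
        ring
      · convert hb (1 / 2) (-1) (by norm_num) (by simp) using 2
        ring
    · simp
      linarith
    · simpa using h2.le
    · rw [mul_assoc, ← Real.exp_add]
      gcongr
      simp
      linarith
  · exact ((integrableOn_exp_neg_Ioi 0).const_mul _)
  · refine Eventually.of_forall fun u => ?_
    exact ContinuousAt.comp (f := fun ν : ℂ => (ν, ((u + c ν : ℝ) : ℂ) + y ν * I)) (hcont ν₀ u)
      (by fun_prop)

theorem continuous_intervalIntegral_neg_self {f : ℂ → ℝ → ℂ} (hf : Continuous (Function.uncurry f))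
    {T : ℂ → ℝ} (hT : Continuous T) : Continuous fun ν => ∫ v in (-T ν)..(T ν), f ν v := by
  -- Splitting at zero leaves one moving endpoint in each integral.
  have e (ν : ℂ) : ∫ v in (-T ν)..(T ν), f ν v =
      (∫ v in (0 : ℝ)..(T ν), f ν v) - ∫ v in (0 : ℝ)..(-T ν), f ν v := by
    have hν : Continuous (f ν) := hf.uncurry_left ν
    rw [intervalIntegral.integral_interval_sub_left (hν.intervalIntegrable _ _)
      (hν.intervalIntegrable _ _)]
  simp only [e]
  exact (intervalIntegral.continuous_parametric_intervalIntegral_of_continuous hf hT).sub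
    (intervalIntegral.continuous_parametric_intervalIntegral_of_continuous hf hT.neg)

theorem continuous_meijerG_rational (ℓ : ℂ) :
    Continuous fun ν => meijerG [-ν / 2, ν / 2] [(1 - ν) / 2, (1 + ν) / 2] ℓ := by
  obtain ⟨c, hcdef⟩ : ∃ c : ℂ → ℝ, c = fun ν => meijerAbscissa [-ν / 2, ν / 2] := ⟨_, rfl⟩
  obtain ⟨T, hTdef⟩ : ∃ T : ℂ → ℝ, T = fun ν => meijerHeight [-ν / 2, ν / 2] := ⟨_, rfl⟩
  have hc : Continuous c := by
    simp only [hcdef, meijerAbscissa, List.map_cons, List.map_nil, List.sum_cons, List.sum_nil]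
    fun_prop
  have hT : Continuous T := by
    simp only [hTdef, meijerHeight, List.map_cons, List.map_nil, List.sum_cons, List.sum_nil]
    fun_prop
  have hTν (ν : ℂ) : |ν.im| / 2 + 1 ≤ T ν := by
    have := abs_im_add_one_le_meijerHeight (b := [-ν / 2, ν / 2]) (c := ν / 2) (by simp)
    rw [hTdef]
    simpa [abs_div] using this
  have hcp (ν : ℂ) : c ν < (-ν / 2).re ∧ c ν < (ν / 2).re := by
    rw [hcdef]
    exact ⟨(meijer_contour_encircles [-ν / 2, ν / 2] (-ν / 2) (by simp)).1,
      (meijer_contour_encircles [-ν / 2, ν / 2] (ν / 2) (by simp)).1⟩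
  have hGc (ν : ℂ) : meijerG [-ν / 2, ν / 2] [(1 - ν) / 2, (1 + ν) / 2] ℓ =
      1 / (2 * Real.pi * I) * loopIntegral (rationalIntegrand ℓ ν) (c ν) (T ν) := by
    rw [hcdef, hTdef]
    rfl
  simp only [hGc, loopIntegral]
  clear hGc hcdef hTdef
  have b1 := continuous_integral_Ioi_rationalIntegrand ℓ hc hT.neg fun ν => by
    rw [Pi.neg_apply, abs_neg]
    exact (hTν ν).trans (le_abs_self _)
  have b2 := continuous_integral_Ioi_rationalIntegrand ℓ hc hT fun ν =>
    (hTν ν).trans (le_abs_self _)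
  have hj : Continuous (Function.uncurry fun (ν : ℂ) (v : ℝ) =>
      rationalIntegrand ℓ ν ((c ν : ℂ) + v * I)) := by
    refine continuous_iff_continuousAt.2 fun ⟨ν, v⟩ => ?_
    have hne {p : ℂ} (hp : c ν < p.re) (m : ℕ) : p - ((c ν : ℂ) + v * I) ≠ -m := fun hm => by
      have h1 : p.re - c ν = -m := by simpa using congrArg re hm
      linarith [m.cast_nonneg (α := ℝ)]
    have hγ : Continuous fun z : ℂ × ℝ => (z.1, (c z.1 : ℂ) + z.2 * I) := by fun_prop
    exact ContinuousAt.comp (f := fun z : ℂ × ℝ => (z.1, (c z.1 : ℂ) + z.2 * I))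
      (g := fun z : ℂ × ℂ => rationalIntegrand ℓ z.1 z.2) (x := (ν, v))
      (continuousAt_rationalIntegrand ℓ (hne (hcp ν).1) (hne (hcp ν).2)) hγ.continuousAt
  have b3 := continuous_intervalIntegral_neg_self hj hT
  simp only [ofReal_neg, neg_mul, ← sub_eq_add_neg, Pi.neg_apply] at b1
  exact continuous_const.mul ((b1.neg.add (continuous_const.mul b3)).add b2)

theorem eventually_two_mul_ne_intCast {ν : ℂ} {n : ℤ} (hn : 2 * ν = n) :
    ∀ᶠ μ : ℂ in 𝓝[≠] ν, ∀ k : ℤ, 2 * μ ≠ k := by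
  have h : ∀ᶠ μ in 𝓝 ν, ‖2 * μ - 2 * ν‖ < 1 :=
    Continuous.continuousAt (by fun_prop : Continuous fun μ => ‖2 * μ - 2 * ν‖)
      |>.eventually_lt_const (by simp)
  filter_upwards [h.filter_mono nhdsWithin_le_nhds, self_mem_nhdsWithin] with μ h1 h2 k hk
  rw [hk, hn, ← Int.cast_sub, norm_intCast] at h1
  have h3 : k - n = 0 := by
    rw [← Int.abs_lt_one_iff]
    exact_mod_cast h1
  have h4 : k = n := by omega
  rw [h4, ← hn] at hk
  exact h2 (mul_left_cancel₀ two_ne_zero hk)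

/-- At integral `2ν` both sides are limits along nearby non-integral orders. This also covers `ν`
integral, where the poles of the two gamma factors coincide. -/
theorem meijerG_rational_bessel {y : ℂ} (hy : y ≠ 0) (ν : ℂ) :
    meijerG [-ν / 2, ν / 2] [(1 - ν) / 2, (1 + ν) / 2] (2 * log (y / 4)) =
      cos (Real.pi * ν) * (2 / Real.pi * besselK (2 * ν) (2 * y ^ (1 / 2 : ℂ))
          - besselY (2 * ν) (2 * y ^ (1 / 2 : ℂ)))
        - sin (Real.pi * ν) * besselJ (2 * ν) (2 * y ^ (1 / 2 : ℂ)) := by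
  by_cases hν : ∃ n : ℤ, 2 * ν = n
  · obtain ⟨n, hn⟩ := hν
    have hmap : Tendsto (fun μ : ℂ => 2 * μ) (𝓝[≠] ν) (𝓝[≠] (n : ℂ)) := by
      rw [← hn]
      refine tendsto_nhdsWithin_iff.2 ⟨?_, ?_⟩
      · exact (Continuous.tendsto (by fun_prop) _).mono_left nhdsWithin_le_nhds
      · filter_upwards [self_mem_nhdsWithin] with μ hμ h
        exact hμ (mul_left_cancel₀ two_ne_zero h)
    have hK := (tendsto_besselKQuot hy n).comp hmap
    have hY := (tendsto_besselYQuot hy n).comp hmap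
    have hJ : Tendsto (fun μ => besselJ (2 * μ) (2 * y ^ (1 / 2 : ℂ))) (𝓝[≠] ν)
        (𝓝 (besselJ (2 * ν) (2 * y ^ (1 / 2 : ℂ)))) := by
      simp only [besselJ_two_mul_sqrt hy]
      have := (differentiable_besselSeries (ε := -1) (by simp) (log y)).continuous
      exact ((this.comp (continuous_const_mul 2)).tendsto ν).mono_left nhdsWithin_le_nhds
    have hcos : Tendsto (fun μ => cos (Real.pi * μ)) (𝓝[≠] ν) (𝓝 (cos (Real.pi * ν))) :=
      (Continuous.tendsto (by fun_prop) _).mono_left nhdsWithin_le_nhds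
    have hsin : Tendsto (fun μ => sin (Real.pi * μ)) (𝓝[≠] ν) (𝓝 (sin (Real.pi * ν))) :=
      (Continuous.tendsto (by fun_prop) _).mono_left nhdsWithin_le_nhds
    have hR := (hcos.mul ((hK.const_mul (2 / Real.pi : ℂ)).sub hY)).sub (hsin.mul hJ)
    have hL := ((continuous_meijerG_rational (2 * log (y / 4))).tendsto ν).mono_left
      (nhdsWithin_le_nhds (s := {ν}ᶜ))
    rw [← hn] at hR
    refine tendsto_nhds_unique (hL.congr' ?_) hR
    filter_upwards [eventually_two_mul_ne_intCast hn] with μ hμ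
    exact meijerG_rational hμ hy
  · rw [besselK, if_neg hν, besselY, if_neg hν]
    push Not at hν
    exact meijerG_rational hν hy

/-! ### The kernels of the two kinds of fields -/

theorem koshliakovKernel_rat (ν y : ℂ) : koshliakovKernel ℚ ν y =
    meijerG [-ν / 2, ν / 2] [(1 - ν) / 2, (1 + ν) / 2] (2 * log (y / 4)) := by
  have h1 := NumberField.InfinitePlace.nrRealPlaces_eq_one_of_finrank_eq_one (K := ℚ)
    (Module.finrank_self ℚ)
  have h2 := NumberField.InfinitePlace.nrComplexPlaces_eq_zero_of_finrank_eq_one (K := ℚ)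
    (Module.finrank_self ℚ)
  simp only [koshliakovKernel, h1, h2]
  rfl

theorem koshliakovKernel_imaginary_quadratic {K : Type*} [Field K] [NumberField K]
    (hd : Module.finrank ℚ K = 2) (hK : NumberField.IsTotallyComplex K) (ν y : ℂ) :
    koshliakovKernel K ν y =
      meijerG [-ν / 2, ν / 2, (1 + ν) / 2] [(1 - ν) / 2, ν / 2, (1 + ν) / 2]
        (2 * log (y / 4)) := by
  have h1 := NumberField.IsTotallyComplex.nrRealPlaces_eq_zero (K := K)
  have h2 : NumberField.InfinitePlace.nrComplexPlaces K = 1 := by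
    have := NumberField.InfinitePlace.card_add_two_mul_card_eq_rank K
    omega
  simp only [koshliakovKernel, h1, h2]
  rfl

end

theorem theorem1p2 :
    (∀ ν x t : ℂ, x ≠ 0 → t ≠ 0 →
      koshliakovKernel ℚ ν (x * t) =
        Complex.cos (Real.pi * ν) *
            (2 / Real.pi * besselK (2 * ν) (2 * (x * t) ^ (1 / 2 : ℂ))
              - besselY (2 * ν) (2 * (x * t) ^ (1 / 2 : ℂ)))
          - Complex.sin (Real.pi * ν) * besselJ (2 * ν) (2 * (x * t) ^ (1 / 2 : ℂ))) ∧
    (∀ (K : Type*) [Field K] [NumberField K],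
      Module.finrank ℚ K = 2 → NumberField.IsTotallyComplex K →
      ∀ ν x t : ℂ, (∀ n : ℤ, 2 * ν ≠ n) → x ≠ 0 → t ≠ 0 →
      koshliakovKernel K ν (x * t) =
        (Real.sqrt Real.pi : ℂ) / Complex.sin (2 * Real.pi * ν) *
          ((2 : ℂ) ^ (1 - 4 * ν) / Complex.Gamma (1 - 2 * ν) ^ 2 * (x * t / 4) ^ (-ν) *
              hypergeometricPFQ [] [1 - ν, 1 - ν, 1 / 2 - ν, 1 / 2 - ν, 1 / 2]
                (-(x ^ 2 * t ^ 2 / 16))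
            - (2 : ℂ) ^ (1 + 2 * ν) * Complex.cos (Real.pi * ν) / Complex.Gamma (1 + 2 * ν) *
                (x * t / 4) ^ ν *
              hypergeometricPFQ [] [1 + ν, 1 / 2 + ν, 1 / 2, 1 / 2, 1]
                (-(x ^ 2 * t ^ 2 / 16))
            + (2 : ℂ) ^ (4 + 2 * ν) * Complex.sin (Real.pi * ν) / Complex.Gamma (2 + 2 * ν) *
                (x * t / 4) ^ (1 + ν) *
              hypergeometricPFQ [] [3 / 2 + ν, 1 + ν, 3 / 2, 3 / 2, 1]
                (-(x ^ 2 * t ^ 2 / 16)))) := by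
  refine ⟨fun ν x t hx ht => ?_, fun K _ _ hd hK ν x t hν hx ht => ?_⟩
  · rw [koshliakovKernel_rat, meijerG_rational_bessel (mul_ne_zero hx ht)]
  · rw [koshliakovKernel_imaginary_quadratic hd hK, meijerG_imaginary_quadratic hν
      (mul_ne_zero hx ht), mul_pow]
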